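/- **Setting.** An attack tree $T=(N,\mathrm{typ},\mathrm{ch})$ consists of a finite set $N$ of nodes, a type in $\{\mathtt{BAS},\mathtt{OR},\mathtt{AND},\mathtt{SAND}\}$ for each node, and for each node $v$ a finite sequence $\mathrm{ch}(v)$ of children in $N$, such that the resulting directed graph is connected and acyclic, there is a unique node $R_T$ without parents (the root), and the $\mathtt{BAS}$ nodes (basic attack steps) are exactly the nodes without children. $T$ is static if it has no $\mathtt{SAND}$ node. Every node counts as a descendant of itself. $T_v$ is the sub-DAG of all descendants of $v$, with root $v$. *Static metric.* An attack is a set $A$ of basic attack steps. It reaches a $\mathtt{BAS}$ node $v$ iff $v\in A$, an $\mathtt{OR}$ node iff it reaches some child, and an $\mathtt{AND}$ node iff it reaches all children. Let $[\![T]\!]$ be the set of $\subseteq$-minimal attacks that reach $R_T$. A semiring attribute domain is a set $V$ with associative and commutative operations $\triangledown,\vartriangle$ such that $\vartriangle$ distributes over $\triangledown$ (neutral elements are not required). For an attribution $\alpha\colon\mathtt{BAS}\to V$ put $\check\alpha(T)=\triangledown_{A\in[\![T]\!]}\,\vartriangle_{a\in A}\alpha(a)$. *Dynamic metric.* An attack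 is a strictly partially ordered set $O=(A,\prec)$ of basic attack steps; attacks are ordered by inclusion of both $A$ and $\prec$. Reaching a $\mathtt{BAS}$, $\mathtt{OR}$ or $\mathtt{AND}$ node is defined as before; $O$ reaches a $\mathtt{SAND}$ node with children $(v_1,\dots,v_n)$ iff it reaches every $v_i$ and, for each $i<n$, $a\prec a'$ whenever $a\in A$ is a descendant of $v_i$ and $a'\in A$ is a descendant of $v_{i+1}$. $T$ is satisfiable if some attack reaches $R_T$. Let $[\![T]\!]_{\min}$ be the set of minimal attacks that reach $R_T$. A semiring dynamic attribute domain is a semiring attribute domain with a further associative and commutative operation $\vartriangleright$ that distributes over $\triangledown$ and $\vartriangle$. For satisfiable $T$ put $\check\alpha(T)=\triangledown_{O\in[\![T]\!]_{\min}}\,\vartriangle_{C}\,\vartriangleright_{a\in C}\alpha(a)$, where $C$ ranges over the maximal chains of $O$. *Modules.* A module of $T$ is a node $v$ that is not a $\mathtt{BAS}$ and is such that every path from a node outside $T_v$ to a node of $T_v$ passes through $v$; that is, $v$ is the only node of $T_v$ that has a parent outside $T_v$. Then $T^v$ is the attack tree obtained from $T$ by replacing $T_v$ by a single new basic attack step $\tilde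 v$. *Modular analysis.* Let $\mathscr A$ be an algorithm that computes the metric $\check\beta(T')$ of every attack tree $T'$ of the kind considered and every attribution $\beta$. Modular analysis, run on $(T,\alpha)$, first lets $U$ be the set of all modules of $T$. While $U\ne\varnothing$, it extracts from $U$ some $v$ that has no other element of $U$ as a descendant, replaces $T$ by $T^v$, and replaces $\alpha$ by the attribution that maps $\tilde v$ to $\mathscr A(T_v,\alpha)$ and agrees with $\alpha$ on all other basic attack steps of $T^v$. When $U=\varnothing$, it returns the attribute of the root. **Statement.** Let either 1. $T$ be a static attack tree, $\alpha$ an attribution into a semiring attribute domain, and let $\mathscr A$ compute the static metric of every static attack tree; or 2. $T$ be an arbitrary attack tree (with or without $\mathtt{SAND}$ nodes), such that $T_v$ is satisfiable for every module $v$ of $T$ (in particular $T$ is satisfiable), $\alpha$ an attribution into a semiring dynamic attribute domain, and let $\mathscr A$ compute the dynamic metric of every satisfiable attack tree. Then modular analysis is correct for $(T,\alpha)$: however the minimal elements of $U$ are chosen, the loop can always be continued while $U\neq\varnothing$, it terminates, and when it ends the root is a basic attack step and the returned value is $\check\alpha(T)$. -/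

import Mathlib

namespace AttackTrees

universe u w

open scoped Classical in
/-- Aggregation `op_{i ∈ s} f i` of a finite nonempty family with an associative and commutative
operation that need not have a neutral element. The value `none` means "undefined"; it arises only
from an empty family. -/
noncomputable def bigOp {V : Type w} (op : V → V → V) [Std.Commutative op] [Std.Associative op]
    {ι : Type u} (s : Finset ι) (f : ι → Option V) : Option V :=
  s.fold (Option.merge op) none f

/-! ### Attack trees -/

/-- Node types. -/
inductive NodeType where
  | BAS
  | OR
  | AND
  | SAND

/-- The data of an attack tree whose nodes are drawn from `N`: a finite set of nodes, the type of
each node, and the sequence of its children. Values of `typ` and `ch` outside `nodes` are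
irrelevant. -/
structure AttackTree (N : Type u) where
  nodes : Finset N
  typ : N → NodeType
  ch : N → List N

namespace AttackTree

variable {N : Type u}

/-- `u` is a child of `v`. -/
def Edge (T : AttackTree N) (v u : N) : Prop := u ∈ T.ch v

/-- `u` is a descendant of `v`; every node is a descendant of itself. -/
def Desc (T : AttackTree N) : N → N → Prop := Relation.ReflTransGen T.Edge

/-- `r` is a node without parents. -/
def IsRoot (T : AttackTree N) (r : N) : Prop :=
  r ∈ T.nodes ∧ ∀ v ∈ T.nodes, r ∉ T.ch v

/-- The constraints on an attack tree: a directed acyclic graph on a finite set of nodes with a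
unique root, whose leaves are exactly the basic attack steps. Connectedness is automatic: in a
finite acyclic graph with a unique root every node is a descendant of the root. -/
structure IsAttackTree (T : AttackTree N) : Prop where
  ch_mem : ∀ v ∈ T.nodes, ∀ u ∈ T.ch v, u ∈ T.nodes
  acyclic : ∀ v ∈ T.nodes, ¬ Relation.TransGen T.Edge v v
  unique_root : ∃! r, T.IsRoot r
  bas_iff_leaf : ∀ v ∈ T.nodes, T.typ v = NodeType.BAS ↔ T.ch v = []

/-- A static attack tree has no sequential gates. -/
def IsStatic (T : AttackTree N) : Prop := ∀ v ∈ T.nodes, T.typ v ≠ NodeType.SAND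

open scoped Classical in
/-- The set of basic attack steps. -/
noncomputable def bas (T : AttackTree N) : Finset N :=
  T.nodes.filter fun v => T.typ v = NodeType.BAS

/-! ### Static semantics -/

/-- `T.StaticReaches A v`: the structure function of a static attack tree takes the value "true"
at the node `v` and the attack `A`. -/
inductive StaticReaches (T : AttackTree N) (A : Finset N) : N → Prop
  | bas (v : N) : T.typ v = NodeType.BAS → v ∈ A → StaticReaches T A v
  | or (v u : N) : T.typ v = NodeType.OR → u ∈ T.ch v → StaticReaches T A u → StaticReaches T A v
  | and (v : N) : T.typ v = NodeType.AND → (∀ u ∈ T.ch v, StaticReaches T A u) →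
      StaticReaches T A v

/-- `A` is a successful attack on a static attack tree: a set of basic attack steps that reaches
the root. -/
def StaticSuccessful (T : AttackTree N) (A : Finset N) : Prop :=
  A ⊆ T.bas ∧ ∃ r, T.IsRoot r ∧ T.StaticReaches A r

open scoped Classical in
/-- The set of minimal successful attacks on a static attack tree. -/
noncomputable def staticMinAttacks (T : AttackTree N) : Finset (Finset N) :=
  T.bas.powerset.filter fun A => Minimal T.StaticSuccessful A

/-! ### Dynamic semantics

An attack on a dynamic attack tree is a strict partial order `(A, ≺)` on a set `A` of basic attack
steps. It is represented by the pair `O = (A, R)`, where `R` is the finite set of all `(a, b)` with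
`a ≺ b`. The order on pairs is componentwise inclusion. -/

/-- `O` is a strictly partially ordered set of basic attack steps. -/
structure IsDynAttack (T : AttackTree N) (O : Finset N × Finset (N × N)) : Prop where
  subset_bas : O.1 ⊆ T.bas
  rel_mem : ∀ a b, (a, b) ∈ O.2 → a ∈ O.1 ∧ b ∈ O.1
  irrefl : ∀ a, (a, a) ∉ O.2
  trans : ∀ a b c, (a, b) ∈ O.2 → (b, c) ∈ O.2 → (a, c) ∈ O.2

/-- `T.DynReaches O v`: the structure function of a dynamic attack tree takes the value "true" at
the node `v` and the attack `O`. A sequential gate requires in addition that, for any two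
consecutive children, the attacked basic steps below the first one all precede those below the
second one. -/
inductive DynReaches (T : AttackTree N) (O : Finset N × Finset (N × N)) : N → Prop
  | bas (v : N) : T.typ v = NodeType.BAS → v ∈ O.1 → DynReaches T O v
  | or (v u : N) : T.typ v = NodeType.OR → u ∈ T.ch v → DynReaches T O u → DynReaches T O v
  | and (v : N) : T.typ v = NodeType.AND → (∀ u ∈ T.ch v, DynReaches T O u) → DynReaches T O v
  | sand (v : N) : T.typ v = NodeType.SAND → (∀ u ∈ T.ch v, DynReaches T O u) →
      (∀ (i : ℕ) (c c' : N), (T.ch v)[i]? = some c → (T.ch v)[i + 1]? = some c' →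
        ∀ a ∈ O.1, ∀ a' ∈ O.1, T.Desc c a → T.Desc c' a' → (a, a') ∈ O.2) →
      DynReaches T O v

/-- `O` is a successful attack on a dynamic attack tree. -/
def DynSuccessful (T : AttackTree N) (O : Finset N × Finset (N × N)) : Prop :=
  T.IsDynAttack O ∧ ∃ r, T.IsRoot r ∧ T.DynReaches O r

/-- An attack tree is satisfiable if it has a successful attack. -/
def Satisfiable (T : AttackTree N) : Prop := ∃ O, T.DynSuccessful O

open scoped Classical in
/-- The set of minimal successful attacks on a dynamic attack tree. -/
noncomputable def dynMinAttacks (T : AttackTree N) : Finset (Finset N × Finset (N × N)) :=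
  (T.bas.powerset ×ˢ (T.bas ×ˢ T.bas).powerset).filter fun O => Minimal T.DynSuccessful O

end AttackTree

open scoped Classical in
/-- The maximal chains of a finite strictly partially ordered set, each given by its set of
elements. -/
noncomputable def maxChains {N : Type u} (O : Finset N × Finset (N × N)) : Finset (Finset N) :=
  O.1.powerset.filter fun C =>
    Maximal (fun C : Finset N => C ⊆ O.1 ∧ IsChain (fun a b => (a, b) ∈ O.2) (C : Set N)) C

/-! ### Attribute domains and metrics -/

/-- A semiring attribute domain: associative and commutative operations `disj` and `conj`, such
that `conj` distributes over `disj`. Neutral elements are not required. -/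
structure SemiringDomain (V : Type w) where
  disj : V → V → V
  conj : V → V → V
  disj_comm : Std.Commutative disj
  disj_assoc : Std.Associative disj
  conj_comm : Std.Commutative conj
  conj_assoc : Std.Associative conj
  conj_disj : ∀ x y z, conj x (disj y z) = disj (conj x y) (conj x z)

/-- A semiring dynamic attribute domain has in addition an associative and commutative operation
`seq` that distributes over `disj` and `conj`. -/
structure SemiringDynDomain (V : Type w) extends SemiringDomain V where
  seq : V → V → V
  seq_comm : Std.Commutative seq
  seq_assoc : Std.Associative seq
  seq_disj : ∀ x y z, seq x (disj y z) = disj (seq x y) (seq x z)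
  seq_conj : ∀ x y z, seq x (conj y z) = conj (seq x y) (seq x z)

attribute [instance] SemiringDomain.disj_comm SemiringDomain.disj_assoc
  SemiringDomain.conj_comm SemiringDomain.conj_assoc
  SemiringDynDomain.seq_comm SemiringDynDomain.seq_assoc

namespace AttackTree

variable {N : Type u} {V : Type w}

/-- The metric of a static attack tree: the disjunction over all minimal attacks of the
conjunction of the attributes of their elements. Only the values of `α` on basic attack steps
matter. -/
noncomputable def staticMetric (D : SemiringDomain V) (T : AttackTree N) (α : N → V) : Option V :=
  bigOp D.disj T.staticMinAttacks fun A => bigOp D.conj A fun a => some (α a)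

/-- The metric of a dynamic attack tree: the disjunction over all minimal attacks of the
conjunction over their maximal chains of the sequential composition of the attributes in the
chain. It is `none` for an unsatisfiable tree. -/
noncomputable def dynMetric (D : SemiringDynDomain V) (T : AttackTree N) (α : N → V) : Option V :=
  bigOp D.disj T.dynMinAttacks fun O =>
    bigOp D.conj (maxChains O) fun C => bigOp D.seq C fun a => some (α a)

/-! ### Modular analysis -/

open scoped Classical in
/-- The subgraph `T[v]` of all descendants of `v`, with root `v`. -/
noncomputable def sub (T : AttackTree N) (v : N) : AttackTree N where
  nodes := T.nodes.filter fun x => T.Desc v x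
  typ := T.typ
  ch := T.ch

/-- A module is an inner node `v` such that no node of `T[v]` other than `v` has a parent outside
of `T[v]`; equivalently, all paths from outside of `T[v]` into `T[v]` pass through `v`. -/
def IsModule (T : AttackTree N) (v : N) : Prop :=
  v ∈ T.nodes ∧ T.typ v ≠ NodeType.BAS ∧
    ∀ x ∈ T.nodes, ¬ T.Desc v x → ∀ y ∈ T.ch x, T.Desc v y → y = v

open scoped Classical in
/-- The set of all modules. -/
noncomputable def modules (T : AttackTree N) : Finset N := T.nodes.filter fun v => T.IsModule v

open scoped Classical in
/-- The tree `T^v`: the subgraph `T[v]` is replaced by a single new basic attack step, which takes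
over the name `v`. -/
noncomputable def contract (T : AttackTree N) (v : N) : AttackTree N where
  nodes := T.nodes.filter fun x => T.Desc v x → x = v
  typ := Function.update T.typ v NodeType.BAS
  ch := Function.update T.ch v []

end AttackTree

/-- A state of the modular analysis: the modules still to be treated, the current attack tree and
the current attribution. -/
structure ModState (N : Type u) (V : Type w) where
  pending : Finset N
  tree : AttackTree N
  attr : N → V

namespace ModState

variable {N : Type u} {V : Type w}

/-- The initial state: all modules of the input tree are pending. -/
noncomputable def init (T : AttackTree N) (α : N → V) : ModState N V where
  pending := T.modules
  tree := T
  attr := α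

open scoped Classical in
/-- The state after treating the module `v`: its metric is computed with the algorithm `alg`, and
`v` is replaced by a basic attack step that carries this value. -/
noncomputable def next (alg : AttackTree N → (N → V) → V) (s : ModState N V) (v : N) :
    ModState N V where
  pending := s.pending.erase v
  tree := s.tree.contract v
  attr := Function.update s.attr v (alg (s.tree.sub v) s.attr)

/-- `v` is a minimal pending module: no other pending module is a descendant of it. -/
def IsMinimalPending (s : ModState N V) (v : N) : Prop :=
  v ∈ s.pending ∧ ∀ x ∈ s.pending, s.tree.Desc v x → x = v

/-- One pass through the loop; it may treat any minimal pending module. -/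
def Step (alg : AttackTree N → (N → V) → V) (s s' : ModState N V) : Prop :=
  ∃ v, s.IsMinimalPending v ∧ s' = s.next alg v

end ModState

/-- Modular analysis with the subroutine `alg`, run on `T` and `α`, correctly returns `x`: however
the minimal modules are chosen, the loop terminates, it never gets stuck while modules are pending,
and once none is pending, the root is a basic attack step whose attribute, which is returned, is
`x`. -/
structure ModularAnalysisReturns {N : Type u} {V : Type w} (alg : AttackTree N → (N → V) → V)
    (T : AttackTree N) (α : N → V) (x : V) : Prop where
  terminates : Acc (fun s' s => ModState.Step alg s s') (ModState.init T α)
  progress : ∀ s, Relation.ReflTransGen (ModState.Step alg) (ModState.init T α) s →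
    s.pending.Nonempty → ∃ s', ModState.Step alg s s'
  output : ∀ s, Relation.ReflTransGen (ModState.Step alg) (ModState.init T α) s →
    s.pending = ∅ →
      (∃! r, s.tree.IsRoot r) ∧
        ∀ r, s.tree.IsRoot r → s.tree.typ r = NodeType.BAS ∧ s.attr r = x

end AttackTrees

/-! It suffices that a single contraction preserves the metric: if `v` is a module, `T.sub v` is
satisfiable and has metric `m`, then `T.contract v`, with `m` as the attribute of `v`, has the same
metric as `T`. The loop then keeps this invariant. The root is itself a module unless it is a basic
attack step, so once nothing is pending the tree has a basic attack step as root, and its metric is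
the attribute of that step.

The combinatorial half of this is a substitution principle: the minimal attacks on `T` are exactly
the attacks `substAttack v O P` with `O` minimal for `T.contract v` and `P` minimal for `T.sub v`
(`IsModule.mem_dynMinAttacks_iff`). Substitution preserves success. Conversely, a successful `Q`
collapses to a successful attack on the contraction: the part below `v` becomes the single step `v`
if `Q` reaches `v` and is dropped otherwise, and two points are ordered if all their preimages are.
Substituting back gives an attack below `Q`. Since substitution also reflects the order
(`le_of_substAttack_le`), minimality passes both ways and `O`, `P` are determined, except that `P`
is irrelevant if `v` does not occur in `O`.

The algebraic half evaluates a substitution. Maximal chains of the result that come from chains of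
`O` avoiding `v` are unchanged; those through `v` become `C.erase v ∪ K` with `K` a maximal chain of
`P`. Distributivity of `seq` over `conj` turns the value into `X △ (Y ▷ value of P)`, where `X` and
`Y` depend on `O` only. The same expression with `m` for the value of `P` is the value of `O` under
the updated attribution, and distributivity over `disj` matches the sum over all `P` with `m`. Here
`X` or `Y` may be empty; `none` then acts as a neutral element.

The static metric needs no separate combinatorics: minimal attacks on a static tree carry the empty
order. `IsModularWeight` isolates what the loop needs from either metric. -/

namespace AttackTrees

universe u w

/-! ### Aggregation without neutral elements -/

section BigOp

variable {V : Type w} {ι κ : Type u}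

/-- `Option V` is a commutative monoid under `Option.merge op`, with neutral element `none`. -/
abbrev mergeMonoid (op : V → V → V) [Std.Commutative op] [Std.Associative op] :
    CommMonoid (Option V) where
  mul := Option.merge op
  one := none
  mul_assoc := (inferInstance : Std.Associative (Option.merge op)).assoc
  mul_comm := (inferInstance : Std.Commutative (Option.merge op)).comm
  one_mul x := by cases x <;> rfl
  mul_one x := by cases x <;> rfl

variable (op : V → V → V) [Std.Commutative op] [Std.Associative op]

theorem merge_comm (x y : Option V) : Option.merge op x y = Option.merge op y x :=
  (mergeMonoid op).mul_comm x y

@[simp] theorem bigOp_singleton (a : ι) (f : ι → Option V) : bigOp op {a} f = f a :=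
  @Finset.prod_singleton _ _ (mergeMonoid op) f a

theorem bigOp_insert [DecidableEq ι] {a : ι} {s : Finset ι} (h : a ∉ s) (f : ι → Option V) :
    bigOp op (insert a s) f = Option.merge op (f a) (bigOp op s f) :=
  @Finset.prod_insert _ _ _ _ (mergeMonoid op) f _ h

theorem bigOp_union [DecidableEq ι] {s t : Finset ι} (h : Disjoint s t) (f : ι → Option V) :
    bigOp op (s ∪ t) f = Option.merge op (bigOp op s f) (bigOp op t f) :=
  @Finset.prod_union _ _ _ _ (mergeMonoid op) f _ h

theorem bigOp_filter (s : Finset ι) (p : ι → Prop) [DecidablePred p] [DecidablePred fun i => ¬ p i]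
    (f : ι → Option V) :
    bigOp op s f = Option.merge op (bigOp op (s.filter p) f) (bigOp op (s.filter fun i => ¬ p i) f) :=
  (@Finset.prod_filter_mul_prod_filter_not _ _ (mergeMonoid op) s p _ _ f).symm

theorem bigOp_congr {s : Finset ι} {f g : ι → Option V} (h : ∀ i ∈ s, f i = g i) :
    bigOp op s f = bigOp op s g := by
  let := mergeMonoid op
  exact Finset.prod_congr (M := Option V) rfl h

theorem bigOp_sigma {κ : ι → Type u} (s : Finset ι) (t : ∀ i, Finset (κ i))
    (f : (Σ i, κ i) → Option V) :
    bigOp op (s.sigma t) f = bigOp op s fun i => bigOp op (t i) fun j => f ⟨i, j⟩ :=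
  @Finset.prod_sigma _ _ (mergeMonoid op) _ s t f

theorem bigOp_product (s : Finset ι) (t : Finset κ) (f : ι × κ → Option V) :
    bigOp op (s ×ˢ t) f = bigOp op s fun i => bigOp op t fun j => f (i, j) :=
  @Finset.prod_product _ _ _ (mergeMonoid op) s t f

theorem bigOp_image [DecidableEq κ] {s : Finset ι} {g : ι → κ} (h : Set.InjOn g s)
    (f : κ → Option V) : bigOp op (s.image g) f = bigOp op s fun i => f (g i) :=
  @Finset.prod_image _ _ _ (mergeMonoid op) f _ s g h

theorem bigOp_isSome {s : Finset ι} (hs : s.Nonempty) {f : ι → Option V}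
    (hf : ∀ i ∈ s, (f i).isSome) : (bigOp op s f).isSome := by
  classical
  induction hs using Finset.Nonempty.cons_induction with
  | singleton a => simpa using hf
  | cons a s ha hs ih =>
    rw [Finset.cons_eq_insert, bigOp_insert op ha]
    have h1 := hf a (Finset.mem_cons_self a s)
    have h2 := ih fun i hi => hf i (Finset.mem_cons_of_mem hi)
    revert h1 h2
    cases f a <;> cases bigOp op s f <;> simp [Option.merge]

/-- Distributivity of `mul` over the aggregation of a nonempty family of defined values. -/
theorem merge_bigOp {mul : V → V → V} (hmul : ∀ x y z, mul x (op y z) = op (mul x y) (mul x z))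
    {s : Finset ι} (hs : s.Nonempty) {f : ι → Option V} (hf : ∀ i ∈ s, (f i).isSome)
    (x : Option V) :
    Option.merge mul x (bigOp op s f) = bigOp op s fun i => Option.merge mul x (f i) := by
  classical
  induction hs using Finset.Nonempty.cons_induction with
  | singleton a => simp
  | cons a s ha hs ih =>
    have h1 := hf a (Finset.mem_cons_self a s)
    have hf' := fun i hi => hf i (Finset.mem_cons_of_mem (b := a) hi)
    have h2 := bigOp_isSome op hs hf'
    rw [Finset.cons_eq_insert, bigOp_insert op ha, bigOp_insert op ha, ← ih hf']
    -- Definedness matters: `Option.merge` treats `none` as neutral, so an undefined member of the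
    -- family would contribute a spurious summand `x` on the right.
    revert h1 h2
    cases x <;> cases f a <;> cases bigOp op s f <;> simp [Option.merge, hmul]

end BigOp

/-! ### Structure of attack trees -/

namespace AttackTree

variable {N : Type u} {T : AttackTree N}

theorem Desc.mem (hT : T.IsAttackTree) {x y : N} (h : T.Desc x y) (hx : x ∈ T.nodes) :
    y ∈ T.nodes := by
  induction h with
  | refl => exact hx
  | tail _ h ih => exact hT.ch_mem _ ih _ h

theorem Desc.antisymm (hT : T.IsAttackTree) {x y : N} (hx : x ∈ T.nodes) (h : T.Desc x y)
    (h' : T.Desc y x) : x = y := by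
  rcases Relation.reflTransGen_iff_eq_or_transGen.1 h with h1 | h1
  · exact h1.symm
  · exact absurd (h1.trans_left h') (hT.acyclic x hx)

theorem not_desc_of_edge (hT : T.IsAttackTree) {x y : N} (hx : x ∈ T.nodes) (h : y ∈ T.ch x) :
    ¬ T.Desc y x := fun h' => hT.acyclic x hx (Relation.TransGen.head' h h')

theorem wellFounded_desc (hT : T.IsAttackTree) :
    WellFounded fun a b : T.nodes => Relation.TransGen T.Edge b.1 a.1 := by
  have : IsTrans T.nodes fun a b => Relation.TransGen T.Edge b.1 a.1 :=
    ⟨fun _ _ _ h h' => h'.trans h⟩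
  have : Std.Irrefl fun a b : T.nodes => Relation.TransGen T.Edge b.1 a.1 :=
    ⟨fun a => hT.acyclic _ a.2⟩
  exact Finite.wellFounded_of_trans_of_irrefl _

theorem wellFounded_anc (hT : T.IsAttackTree) :
    WellFounded fun a b : T.nodes => Relation.TransGen T.Edge a.1 b.1 := by
  have : IsTrans T.nodes fun a b => Relation.TransGen T.Edge a.1 b.1 :=
    ⟨fun _ _ _ h h' => h.trans h'⟩
  have : Std.Irrefl fun a b : T.nodes => Relation.TransGen T.Edge a.1 b.1 :=
    ⟨fun a => hT.acyclic _ a.2⟩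
  exact Finite.wellFounded_of_trans_of_irrefl _

/-- Induction from the leaves to the root. -/
theorem node_induction (hT : T.IsAttackTree) {p : N → Prop}
    (h : ∀ x ∈ T.nodes, (∀ y ∈ T.ch x, p y) → p x) {x : N} (hx : x ∈ T.nodes) : p x := by
  suffices ∀ a : T.nodes, p a.1 from this ⟨x, hx⟩
  intro a
  induction a using (wellFounded_desc hT).induction with
  | _ a ih => exact h a.1 a.2 fun y hy => ih ⟨y, hT.ch_mem _ a.2 _ hy⟩ (.single hy)

/-- Climbing through parents terminates by acyclicity and finiteness, and can only end at the unique
root. -/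
theorem IsRoot.desc (hT : T.IsAttackTree) {r : N} (hr : T.IsRoot r) {x : N} (hx : x ∈ T.nodes) :
    T.Desc r x := by
  suffices ∀ a : T.nodes, T.Desc r a.1 from this ⟨x, hx⟩
  intro a
  induction a using (wellFounded_anc hT).induction with
  | _ a ih =>
    by_cases ha : T.IsRoot a.1
    · rw [hT.unique_root.unique hr ha]; exact .refl
    · simp only [IsRoot, not_and, not_forall, not_not] at ha
      obtain ⟨p, hp, h⟩ := ha a.2
      exact (ih ⟨p, hp⟩ (.single h)).tail h

/-- This puts the root among the pending modules, so the loop cannot end before the root has become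
a basic attack step. -/
theorem IsRoot.isModule (hT : T.IsAttackTree) {r : N} (hr : T.IsRoot r)
    (h : T.typ r ≠ NodeType.BAS) : T.IsModule r :=
  ⟨hr.1, h, fun _ hx h' => absurd (hr.desc hT hx) h'⟩

/-- The first node of the path that lies below `v` has its predecessor outside, so the module
condition forces it to be `v`. -/
theorem IsModule.desc_of_desc {v : N} (hT : T.IsAttackTree) (hv : T.IsModule v) {x y : N}
    (hx : x ∈ T.nodes) (hxy : T.Desc x y) (hvx : ¬ T.Desc v x) (hvy : T.Desc v y) :
    T.Desc x v := by
  induction hxy with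
  | refl => exact absurd hvy hvx
  | @tail b c hb hbc ih =>
    by_cases h : T.Desc v b
    · exact ih h
    · rw [← hv.2.2 b (Desc.mem hT hb hx) h c hbc hvy]
      exact hb.tail hbc

@[simp] theorem mem_bas {x : N} : x ∈ T.bas ↔ x ∈ T.nodes ∧ T.typ x = NodeType.BAS := by
  simp [bas]

@[simp] theorem mem_modules {x : N} : x ∈ T.modules ↔ T.IsModule x := by
  simp only [modules, Finset.mem_filter, and_iff_right_iff_imp]
  exact fun h => h.1

/-! #### Subtrees -/

@[simp] theorem mem_nodes_sub {v x : N} : x ∈ (T.sub v).nodes ↔ x ∈ T.nodes ∧ T.Desc v x := by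
  simp [sub]

theorem isRoot_sub_iff (hT : T.IsAttackTree) {v : N} (hv : v ∈ T.nodes) {r : N} :
    (T.sub v).IsRoot r ↔ r = v := by
  constructor
  · rintro ⟨h, h'⟩
    obtain ⟨hr, hd⟩ := mem_nodes_sub.1 h
    rcases Relation.ReflTransGen.cases_tail hd with h1 | ⟨p, h1, h2⟩
    · exact h1
    · exact absurd h2 (h' p (mem_nodes_sub.2 ⟨Desc.mem hT h1 hv, h1⟩))
  · rintro rfl
    refine ⟨mem_nodes_sub.2 ⟨hv, .refl⟩, fun x hx hvx => ?_⟩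
    obtain ⟨hx, hd⟩ := mem_nodes_sub.1 hx
    exact not_desc_of_edge hT hx hvx hd

theorem IsAttackTree.sub (hT : T.IsAttackTree) {v : N} (hv : v ∈ T.nodes) :
    (T.sub v).IsAttackTree where
  ch_mem x hx u hu := by
    obtain ⟨hx, hd⟩ := mem_nodes_sub.1 hx
    exact mem_nodes_sub.2 ⟨hT.ch_mem x hx u hu, hd.tail hu⟩
  acyclic x hx := hT.acyclic x (mem_nodes_sub.1 hx).1
  unique_root := ⟨v, (isRoot_sub_iff hT hv).2 rfl, fun _ h => (isRoot_sub_iff hT hv).1 h⟩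
  bas_iff_leaf x hx := hT.bas_iff_leaf x (mem_nodes_sub.1 hx).1

theorem IsStatic.sub (hT : T.IsStatic) (v : N) : (T.sub v).IsStatic :=
  fun x hx => hT x (mem_nodes_sub.1 hx).1

/-! #### Contraction of a module -/

@[simp] theorem mem_nodes_contract {v x : N} :
    x ∈ (T.contract v).nodes ↔ x ∈ T.nodes ∧ (T.Desc v x → x = v) := by
  simp [contract]

theorem typ_contract {v x : N} (h : x ≠ v) : (T.contract v).typ x = T.typ x := by
  simp [contract, h]

@[simp] theorem typ_contract_self {v : N} : (T.contract v).typ v = NodeType.BAS := by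
  simp [contract]

theorem ch_contract {v x : N} (h : x ≠ v) : (T.contract v).ch x = T.ch x := by
  simp [contract, h]

@[simp] theorem ch_contract_self {v : N} : (T.contract v).ch v = [] := by
  simp [contract]

theorem edge_of_contract {v x y : N} (h : (T.contract v).Edge x y) : x ≠ v ∧ T.Edge x y := by
  by_cases hx : x = v
  · subst hx; simp [Edge] at h
  · exact ⟨hx, by simpa [Edge, ch_contract hx] using h⟩

theorem edge_contract {v x y : N} (hx : x ≠ v) (h : T.Edge x y) : (T.contract v).Edge x y := by
  simpa [Edge, ch_contract hx] using h

theorem desc_of_contract {v x y : N} (h : (T.contract v).Desc x y) : T.Desc x y :=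
  Relation.ReflTransGen.mono (fun _ _ h => (edge_of_contract h).2) _ _ h

/-- A path to a surviving node never passes through `v` properly: once it meets `v`, its end lies
below `v` and is therefore `v`. The condition `hxv` treats paths that start at `v`, which has no
children after contraction. -/
theorem desc_contract (hT : T.IsAttackTree) {v x y : N}
    (hx : x ∈ T.nodes) (hy : y ∈ (T.contract v).nodes) (h : T.Desc x y)
    (hxv : x = v → y = v) :
    (T.contract v).Desc x y := by
  by_cases hxv' : x = v
  · rw [hxv', hxv hxv']; exact .refl
  induction h using Relation.ReflTransGen.head_induction_on with
  | refl => exact .refl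
  | @head a c hac hcy ih =>
    refine Relation.ReflTransGen.head (edge_contract hxv' hac) ?_
    by_cases hc : c = v
    · have := (mem_nodes_contract.1 hy).2 (hc ▸ hcy)
      rw [hc, this]
    · exact ih (hT.ch_mem _ hx _ hac) (fun h => absurd h hc) hc

theorem desc_contract_iff (hT : T.IsAttackTree) {v x y : N}
    (hx : x ∈ (T.contract v).nodes) (hy : y ∈ (T.contract v).nodes) :
    (T.contract v).Desc x y ↔ T.Desc x y := by
  refine ⟨desc_of_contract, fun h => desc_contract hT (mem_nodes_contract.1 hx).1 hy h ?_⟩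
  rintro rfl
  exact (mem_nodes_contract.1 hy).2 h

theorem IsModule.ch_mem_contract {v : N} (hT : T.IsAttackTree) (hv : T.IsModule v) {x u : N}
    (hx : x ∈ (T.contract v).nodes) (hxv : x ≠ v) (hu : u ∈ T.ch x) :
    u ∈ (T.contract v).nodes := by
  obtain ⟨hx, hd⟩ := mem_nodes_contract.1 hx
  exact mem_nodes_contract.2 ⟨hT.ch_mem x hx u hu, hv.2.2 x hx (fun h => hxv (hd h)) u hu⟩

/-- A parent below `v` of a surviving node would put that node below `v`, hence make it `v` and
close a cycle; so contraction creates no new root. -/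
theorem IsModule.isRoot_contract_iff {v : N} (hT : T.IsAttackTree) (hv : T.IsModule v) {r : N} :
    (T.contract v).IsRoot r ↔ T.IsRoot r := by
  constructor
  · rintro ⟨h, h'⟩
    obtain ⟨hr, hd⟩ := mem_nodes_contract.1 h
    refine ⟨hr, fun p hp hrp => ?_⟩
    by_cases hpv : T.Desc v p
    · obtain rfl := hd (hpv.tail hrp)
      exact not_desc_of_edge hT hp hrp hpv
    · have hne : p ≠ v := fun h => hpv (h ▸ .refl)
      exact h' p (mem_nodes_contract.2 ⟨hp, fun h => absurd h hpv⟩) (by rwa [ch_contract hne])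
  · rintro ⟨hr, h'⟩
    refine ⟨mem_nodes_contract.2 ⟨hr, fun h => ?_⟩, fun p hp hrp => ?_⟩
    · rcases Relation.ReflTransGen.cases_tail h with h1 | ⟨p, h1, h2⟩
      · exact h1
      · exact absurd h2 (h' p (Desc.mem hT h1 hv.1))
    · exact h' p (mem_nodes_contract.1 hp).1 (edge_of_contract hrp).2

theorem IsModule.contract_isAttackTree {v : N} (hT : T.IsAttackTree) (hv : T.IsModule v) :
    (T.contract v).IsAttackTree where
  ch_mem x hx u hu := by
    obtain ⟨hxv, hu⟩ := edge_of_contract hu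
    exact hv.ch_mem_contract hT hx hxv hu
  acyclic x hx h := hT.acyclic x (mem_nodes_contract.1 hx).1
    (Relation.TransGen.mono (fun _ _ h => (edge_of_contract h).2) _ _ h)
  unique_root := by simpa only [hv.isRoot_contract_iff hT] using hT.unique_root
  bas_iff_leaf x hx := by
    by_cases h : x = v
    · subst h; simp
    · rw [typ_contract h, ch_contract h]
      exact hT.bas_iff_leaf x (mem_nodes_contract.1 hx).1

theorem IsStatic.contract (hT : T.IsStatic) (v : N) : (T.contract v).IsStatic := by
  intro x hx
  by_cases h : x = v
  · subst h; simp
  · rw [typ_contract h]; exact hT x (mem_nodes_contract.1 hx).1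

/-- A module that is not below `v` stays a module when `v` is contracted. -/
theorem IsModule.contract {v x : N} (hT : T.IsAttackTree) (hx : T.IsModule x) (hne : x ≠ v)
    (hvx : ¬ T.Desc v x) : (T.contract v).IsModule x := by
  have hx' : x ∈ (T.contract v).nodes := mem_nodes_contract.2 ⟨hx.1, fun h => absurd h hvx⟩
  refine ⟨hx', by rw [typ_contract hne]; exact hx.2.1, fun p hp hxp y hy hxy => ?_⟩
  rw [desc_contract_iff hT hx' hp] at hxp
  exact hx.2.2 p (mem_nodes_contract.1 hp).1 hxp y (edge_of_contract hy).2 (desc_of_contract hxy)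

end AttackTree

/-! ### Substitution of attacks -/

/-- An attack, given by its set of elements and its order relation. -/
abbrev Attack (N : Type u) := Finset N × Finset (N × N)

section Subst

variable {N : Type u}

open scoped Classical in
/-- The map that collapses the set of all `x` with `p x` to the point `v`. -/
noncomputable def collapseMap (v : N) (p : N → Prop) (x : N) : N := if p x then v else x

theorem collapseMap_pos {v x : N} {p : N → Prop} (h : p x) : collapseMap v p x = v := if_pos h

theorem collapseMap_neg {v x : N} {p : N → Prop} (h : ¬ p x) : collapseMap v p x = x := if_neg h

open scoped Classical in
/-- The attack obtained from `O` by replacing its element `v`, if present, by the attack `P`. -/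
noncomputable def substAttack (v : N) (O P : Attack N) : Attack N :=
  let A := (O.1 ∪ P.1).filter fun x => x ≠ v ∧ collapseMap v (· ∈ P.1) x ∈ O.1
  (A, (A ×ˢ A).filter fun x => x ∈ P.2 ∨
    (collapseMap v (· ∈ P.1) x.1, collapseMap v (· ∈ P.1) x.2) ∈ O.2)

theorem mem_substAttack_fst {v : N} {O P : Attack N} {x : N} :
    x ∈ (substAttack v O P).1 ↔ x ≠ v ∧ (x ∈ P.1 ∧ v ∈ O.1 ∨ x ∉ P.1 ∧ x ∈ O.1) := by
  simp only [substAttack, Finset.mem_filter, Finset.mem_union]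
  by_cases h : x ∈ P.1
  · simp [collapseMap_pos (p := (· ∈ P.1)) h, h]
  · simp only [collapseMap_neg (p := (· ∈ P.1)) h, h]; tauto

theorem mem_substAttack_snd {v : N} {O P : Attack N} {x y : N} :
    (x, y) ∈ (substAttack v O P).2 ↔ x ∈ (substAttack v O P).1 ∧ y ∈ (substAttack v O P).1 ∧
      ((x, y) ∈ P.2 ∨ (collapseMap v (· ∈ P.1) x, collapseMap v (· ∈ P.1) y) ∈ O.2) := by
  simp only [substAttack, Finset.mem_filter, Finset.mem_product, and_assoc]

/-- `O` is a strictly partially ordered set. -/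
structure IsOrderedSet (O : Attack N) : Prop where
  rel_mem : ∀ a b, (a, b) ∈ O.2 → a ∈ O.1 ∧ b ∈ O.1
  irrefl : ∀ a, (a, a) ∉ O.2
  trans : ∀ a b c, (a, b) ∈ O.2 → (b, c) ∈ O.2 → (a, c) ∈ O.2

/-- The conditions under which `P` may be substituted for `v` in `O`. -/
structure Substitutable (v : N) (O P : Attack N) : Prop where
  left : IsOrderedSet O
  right : IsOrderedSet P
  nonempty : P.1.Nonempty
  notMem : v ∉ P.1
  disjoint : ∀ x ∈ P.1, x ∉ O.1

theorem collapseMap_mem_of_mem_subst {v : N} {O P : Attack N} {x : N}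
    (h : x ∈ (substAttack v O P).1) : collapseMap v (· ∈ P.1) x ∈ O.1 := by
  by_cases h' : x ∈ P.1
  · rw [collapseMap_pos (p := (· ∈ P.1)) h']; rw [mem_substAttack_fst] at h; tauto
  · rw [collapseMap_neg (p := (· ∈ P.1)) h']; rw [mem_substAttack_fst] at h; tauto

/-- This is a lexicographic composition. In the mixed cases of transitivity, a pair related in `P`
has both ends collapsed to `v`, so one end can replace the other in a relation of `O`. -/
theorem Substitutable.subst_isOrderedSet {v : N} {O P : Attack N} (h : Substitutable v O P) :
    IsOrderedSet (substAttack v O P) := by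
  refine ⟨fun a b hab => ?_, fun a ha => ?_, fun a b c hab hbc => ?_⟩
  · rw [mem_substAttack_snd] at hab; exact ⟨hab.1, hab.2.1⟩
  · rw [mem_substAttack_snd] at ha
    rcases ha.2.2 with h' | h'
    · exact h.right.irrefl _ h'
    · exact h.left.irrefl _ h'
  · rw [mem_substAttack_snd] at hab hbc ⊢
    refine ⟨hab.1, hbc.2.1, ?_⟩
    rcases hab.2.2 with h1 | h1 <;> rcases hbc.2.2 with h2 | h2
    · exact .inl (h.right.trans _ _ _ h1 h2)
    · have := h.right.rel_mem _ _ h1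
      rw [collapseMap_pos (p := (· ∈ P.1)) this.2] at h2
      rw [collapseMap_pos (p := (· ∈ P.1)) this.1]
      exact .inr h2
    · have := h.right.rel_mem _ _ h2
      rw [collapseMap_pos (p := (· ∈ P.1)) this.1] at h1
      rw [collapseMap_pos (p := (· ∈ P.1)) this.2]
      exact .inr h1
    · exact .inr (h.left.trans _ _ _ h1 h2)

/-- The two collapse maps agree on the smaller substitution, because `hd` prevents a point kept from
`O` from lying in `P'`. -/
theorem substAttack_mono {v : N} {O O' P P' : Attack N} (hd : ∀ x ∈ P'.1, x ∉ O.1) (hO : O ≤ O') (hP : P ≤ P') :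
    substAttack v O P ≤ substAttack v O' P' := by
  have h1 : (substAttack v O P).1 ⊆ (substAttack v O' P').1 := by
    intro x hx
    rw [mem_substAttack_fst] at hx ⊢
    refine ⟨hx.1, ?_⟩
    rcases hx.2 with ⟨h2, h3⟩ | ⟨h2, h3⟩
    · exact .inl ⟨hP.1 h2, hO.1 h3⟩
    · exact .inr ⟨fun h4 => hd x h4 h3, hO.1 h3⟩
  refine ⟨h1, ?_⟩
  rintro ⟨x, y⟩ hxy
  rw [mem_substAttack_snd] at hxy ⊢
  refine ⟨h1 hxy.1, h1 hxy.2.1, hxy.2.2.imp (fun h => hP.2 h) fun h2 => ?_⟩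
  have key : ∀ z ∈ (substAttack v O P).1,
      collapseMap v (· ∈ P'.1) z = collapseMap v (· ∈ P.1) z := by
    intro z hz
    rw [mem_substAttack_fst] at hz
    rcases hz.2 with ⟨h2, h3⟩ | ⟨h2, h3⟩
    · rw [collapseMap_pos (p := (· ∈ P.1)) h2, collapseMap_pos (p := (· ∈ P'.1)) (hP.1 h2)]
    · rw [collapseMap_neg (p := (· ∈ P.1)) h2,
        collapseMap_neg (p := (· ∈ P'.1)) fun h4 => hd z h4 h3]
  rw [key x hxy.1, key y hxy.2.1]
  exact hO.2 h2

/-- Substitution reflects the order of attacks. -/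
theorem le_of_substAttack_le {v : N} {O O' P P' : Attack N} (h : Substitutable v O P)
    (h' : Substitutable v O' P') (hd : ∀ x ∈ P.1, x ∉ O'.1) (hd' : ∀ x ∈ P'.1, x ∉ O.1)
    (hle : substAttack v O P ≤ substAttack v O' P') :
    O ≤ O' ∧ (v ∈ O.1 → P ≤ P') := by
  have hvP := h.notMem
  have hvP' := h'.notMem
  have key : v ∈ O.1 → v ∈ O'.1 ∧ P ≤ P' := by
    intro hv
    have h1 : ∀ x ∈ P.1, x ∈ (substAttack v O P).1 := fun x hx =>
      mem_substAttack_fst.2 ⟨fun e => hvP (e ▸ hx), .inl ⟨hx, hv⟩⟩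
    have h2 : ∀ x ∈ P.1, x ∈ P'.1 ∧ v ∈ O'.1 := fun x hx => by
      have := mem_substAttack_fst.1 (hle.1 (h1 x hx))
      have := hd x hx
      tauto
    obtain ⟨b, hb⟩ := h.nonempty
    refine ⟨(h2 b hb).2, fun x hx => (h2 x hx).1, ?_⟩
    rintro ⟨x, y⟩ hxy
    obtain ⟨hx, hy⟩ := h.right.rel_mem _ _ hxy
    have := (mem_substAttack_snd.1 (hle.2 (mem_substAttack_snd.2
      ⟨h1 x hx, h1 y hy, .inl hxy⟩))).2.2
    rw [collapseMap_pos (p := (· ∈ P'.1)) (h2 x hx).1,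
      collapseMap_pos (p := (· ∈ P'.1)) (h2 y hy).1] at this
    -- Both points collapse to `v`, so their relation cannot come from the irreflexive order of
    -- `O'`.
    exact this.resolve_right (h'.left.irrefl v)
  -- Each point of `O` gets a representative in the substitution that both collapse maps send back
  -- to it: the point itself, or any element of `P` for `v`.
  have fibre : ∀ x ∈ O.1, ∃ a ∈ (substAttack v O P).1, collapseMap v (· ∈ P.1) a = x ∧
      collapseMap v (· ∈ P'.1) a = x ∧ (x ≠ v → a ∉ P'.1) := by
    intro x hx
    by_cases hxv : x = v
    · subst hxv
      obtain ⟨b, hb⟩ := h.nonempty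
      exact ⟨b, mem_substAttack_fst.2 ⟨fun e => hvP (e ▸ hb), .inl ⟨hb, hx⟩⟩,
        collapseMap_pos hb, collapseMap_pos (p := (· ∈ P'.1)) ((key hx).2.1 hb),
        fun h => absurd rfl h⟩
    · have h1 : x ∉ P.1 := fun h' => h.disjoint x h' hx
      have h2 : x ∉ P'.1 := fun h' => hd' x h' hx
      exact ⟨x, mem_substAttack_fst.2 ⟨hxv, .inr ⟨h1, hx⟩⟩, collapseMap_neg h1,
        collapseMap_neg (p := (· ∈ P'.1)) h2, fun _ => h2⟩
  refine ⟨⟨fun x hx => ?_, ?_⟩, fun hv => (key hv).2⟩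
  · obtain ⟨a, ha, -, h2, -⟩ := fibre x hx
    rw [← h2]
    exact collapseMap_mem_of_mem_subst (hle.1 ha)
  · rintro ⟨x, y⟩ hxy
    obtain ⟨hx, hy⟩ := h.left.rel_mem _ _ hxy
    obtain ⟨a, ha, h1, h2, h3⟩ := fibre x hx
    obtain ⟨b, hb, h1', h2', h3'⟩ := fibre y hy
    have := (mem_substAttack_snd.1 (hle.2 (mem_substAttack_snd.2
      ⟨ha, hb, .inr (by rwa [h1, h1'])⟩))).2.2
    rw [h2, h2'] at this
    -- A relation inside `P'` can only join two representatives of `v`, which would give `v ≺ v` in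
    -- `O`.
    refine this.resolve_left fun h4 => ?_
    obtain ⟨h5, h6⟩ := h'.right.rel_mem _ _ h4
    have hxv : x = v := by by_contra h; exact h3 h h5
    have hyv : y = v := by by_contra h; exact h3' h h6
    rw [hxv, hyv] at hxy
    exact h.left.irrefl v hxy

/-- Here the substitution forgets `P`; this is the only failure of injectivity in the later
parametrization. -/
theorem substAttack_of_notMem {v : N} {O P : Attack N} (h : Substitutable v O P) (hv : v ∉ O.1) :
    substAttack v O P = O := by
  have h1 : ∀ x, x ∈ (substAttack v O P).1 ↔ x ∈ O.1 := by
    intro x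
    rw [mem_substAttack_fst]
    constructor
    · tauto
    · intro hx
      exact ⟨fun e => hv (e ▸ hx), .inr ⟨fun h' => h.disjoint x h' hx, hx⟩⟩
  have h3 : ∀ x ∈ O.1, x ∉ P.1 := fun x hx h' => h.disjoint x h' hx
  refine Prod.ext (Finset.ext h1) (Finset.ext ?_)
  rintro ⟨x, y⟩
  rw [mem_substAttack_snd, h1, h1]
  constructor
  · rintro ⟨hx, hy, h2⟩
    rw [collapseMap_neg (p := (· ∈ P.1)) (h3 x hx),
      collapseMap_neg (p := (· ∈ P.1)) (h3 y hy)] at h2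
    exact h2.resolve_left fun h4 => h3 x hx (h.right.rel_mem _ _ h4).1
  · intro hxy
    obtain ⟨hx, hy⟩ := h.left.rel_mem _ _ hxy
    refine ⟨hx, hy, .inr ?_⟩
    rwa [collapseMap_neg (p := (· ∈ P.1)) (h3 x hx), collapseMap_neg (p := (· ∈ P.1)) (h3 y hy)]

end Subst

/-! ### Locality of reachability and restriction of attacks to a subtree -/

namespace AttackTree

variable {N : Type u} {T : AttackTree N}

theorem IsDynAttack.isOrderedSet {O : Attack N} (h : T.IsDynAttack O) : IsOrderedSet O :=
  ⟨h.rel_mem, h.irrefl, h.trans⟩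

/-- Whether an attack reaches a node depends only on the part below the node. -/
theorem DynReaches.transfer {T₁ T₂ : AttackTree N} {O₁ O₂ : Attack N} {x : N}
    (h : T₁.DynReaches O₁ x)
    (hT : ∀ y, T₁.Desc x y → T₂.typ y = T₁.typ y ∧ T₂.ch y = T₁.ch y)
    (hA : ∀ y, T₁.Desc x y → (y ∈ O₁.1 ↔ y ∈ O₂.1))
    (hR : ∀ a b, T₁.Desc x a → T₁.Desc x b → (a, b) ∈ O₁.2 → (a, b) ∈ O₂.2) :
    T₂.DynReaches O₂ x := by
  -- A sequential gate of `T₂` refers to descendants in `T₂`, whereas the hypotheses control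
  -- descendants in `T₁`.
  have hdesc : ∀ c a, T₁.Desc x c → T₂.Desc c a → T₁.Desc c a := by
    intro c a hc h
    induction h with
    | refl => exact .refl
    | @tail b d _ hbd ih =>
      refine ih.tail ?_
      simpa [Edge, (hT b (hc.trans ih)).2] using hbd
  induction h with
  | bas v h1 h2 => exact .bas v ((hT v .refl).1.trans h1) ((hA v .refl).1 h2)
  | or v u h1 h2 h3 ih =>
    refine .or v u ((hT v .refl).1.trans h1) ((hT v .refl).2 ▸ h2) (ih ?_ ?_ ?_ ?_)
    · exact fun y hy => hT y (.head h2 hy)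
    · exact fun y hy => hA y (.head h2 hy)
    · exact fun a b ha hb => hR a b (.head h2 ha) (.head h2 hb)
    · exact fun c a hc => hdesc c a (.head h2 hc)
  | and v h1 h2 ih =>
    refine .and v ((hT v .refl).1.trans h1) fun u hu => ?_
    rw [(hT v .refl).2] at hu
    apply ih u hu
    · exact fun y hy => hT y (.head hu hy)
    · exact fun y hy => hA y (.head hu hy)
    · exact fun a b ha hb => hR a b (.head hu ha) (.head hu hb)
    · exact fun c a hc => hdesc c a (.head hu hc)
  | sand v h1 h2 h3 ih =>
    refine .sand v ((hT v .refl).1.trans h1) (fun u hu => ?_) ?_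
    · rw [(hT v .refl).2] at hu
      apply ih u hu
      · exact fun y hy => hT y (.head hu hy)
      · exact fun y hy => hA y (.head hu hy)
      · exact fun a b ha hb => hR a b (.head hu ha) (.head hu hb)
      · exact fun c a hc => hdesc c a (.head hu hc)
    · intro i c c' hc hc' a ha a' ha' hca hca'
      rw [(hT v .refl).2] at hc hc'
      have hvc : T₁.Desc v c := .single (List.mem_of_getElem? hc)
      have hvc' : T₁.Desc v c' := .single (List.mem_of_getElem? hc')
      have hca := hdesc c a hvc hca
      have hca' := hdesc c' a' hvc' hca'
      have hva := hvc.trans hca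
      have hva' := hvc'.trans hca'
      exact hR a a' hva hva' (h3 i c c' hc hc' a ((hA a hva).2 ha) a' ((hA a' hva').2 ha') hca hca')

theorem dynReaches_sub {v x : N} {O : Attack N} :
    (T.sub v).DynReaches O x ↔ T.DynReaches O x :=
  ⟨fun h => h.transfer (fun _ _ => ⟨rfl, rfl⟩) (fun _ _ => .rfl) (fun _ _ _ _ h => h),
    fun h => h.transfer (fun _ _ => ⟨rfl, rfl⟩) (fun _ _ => .rfl) (fun _ _ _ _ h => h)⟩

/-- Inner nodes have children, so no `AND` or `SAND` gate is reached vacuously. -/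
theorem DynReaches.nonempty (hT : T.IsAttackTree) {O : Attack N} {x : N} (hx : x ∈ T.nodes)
    (h : T.DynReaches O x) : ∃ a ∈ O.1, T.Desc x a := by
  have aux : ∀ x ∈ T.nodes, T.typ x ≠ NodeType.BAS → ∃ u, u ∈ T.ch x := by
    intro x hx h
    rw [Ne, hT.bas_iff_leaf x hx] at h
    exact List.exists_mem_of_ne_nil _ h
  induction h with
  | bas v _ h => exact ⟨v, h, .refl⟩
  | or v u h1 h2 h3 ih =>
    obtain ⟨a, ha, hd⟩ := ih (hT.ch_mem v hx u h2)
    exact ⟨a, ha, .head h2 hd⟩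
  | and v h1 h2 ih =>
    obtain ⟨u, hu⟩ := aux v hx (by simp [h1])
    obtain ⟨a, ha, hd⟩ := ih u hu (hT.ch_mem v hx u hu)
    exact ⟨a, ha, .head hu hd⟩
  | sand v h1 h2 h3 ih =>
    obtain ⟨u, hu⟩ := aux v hx (by simp [h1])
    obtain ⟨a, ha, hd⟩ := ih u hu (hT.ch_mem v hx u hu)
    exact ⟨a, ha, .head hu hd⟩

theorem mem_bas_sub {v x : N} : x ∈ (T.sub v).bas ↔ x ∈ T.bas ∧ T.Desc v x := by
  simp only [mem_bas, mem_nodes_sub]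
  exact ⟨fun h => ⟨⟨h.1.1, h.2⟩, h.1.2⟩, fun h => ⟨⟨h.1.1, h.2⟩, h.1.2⟩⟩

open scoped Classical in
/-- The restriction of an attack to the basic attack steps below `v`. -/
noncomputable def restrictAttack (T : AttackTree N) (v : N) (O : Attack N) : Attack N :=
  (O.1.filter (T.Desc v), O.2.filter fun x => T.Desc v x.1 ∧ T.Desc v x.2)

theorem mem_restrictAttack_fst {v x : N} {O : Attack N} :
    x ∈ (T.restrictAttack v O).1 ↔ x ∈ O.1 ∧ T.Desc v x := by
  simp [restrictAttack]

theorem mem_restrictAttack_snd {v x y : N} {O : Attack N} :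
    (x, y) ∈ (T.restrictAttack v O).2 ↔ (x, y) ∈ O.2 ∧ T.Desc v x ∧ T.Desc v y := by
  simp [restrictAttack]

theorem IsDynAttack.restrict {O : Attack N} (h : T.IsDynAttack O) (v : N) :
    (T.sub v).IsDynAttack (T.restrictAttack v O) := by
  constructor
  · intro x hx
    obtain ⟨hx, hd⟩ := (mem_restrictAttack_fst).1 hx
    exact mem_bas_sub.2 ⟨h.subset_bas hx, hd⟩
  · intro a b hab
    rw [mem_restrictAttack_snd] at hab
    rw [mem_restrictAttack_fst, mem_restrictAttack_fst]
    have := h.rel_mem _ _ hab.1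
    tauto
  · intro a ha
    exact h.irrefl a (mem_restrictAttack_snd.1 ha).1
  · intro a b c hab hbc
    rw [mem_restrictAttack_snd] at hab hbc ⊢
    exact ⟨h.trans _ _ _ hab.1 hbc.1, hab.2.1, hbc.2.2⟩

theorem DynReaches.restrict {O : Attack N} {v : N} (h : T.DynReaches O v) :
    T.DynReaches (T.restrictAttack v O) v := by
  refine h.transfer (fun _ _ => ⟨rfl, rfl⟩) (fun y hy => ?_) fun a b ha hb hab => ?_
  · simp [mem_restrictAttack_fst, hy]
  · exact mem_restrictAttack_snd.2 ⟨hab, ha, hb⟩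

theorem dynSuccessful_sub_iff (hT : T.IsAttackTree) {v : N} (hv : v ∈ T.nodes) {O : Attack N} :
    (T.sub v).DynSuccessful O ↔ (T.sub v).IsDynAttack O ∧ T.DynReaches O v := by
  simp only [DynSuccessful, isRoot_sub_iff hT hv, exists_eq_left, dynReaches_sub]

theorem IsDynAttack.of_sub {v : N} {O : Attack N} (h : (T.sub v).IsDynAttack O) :
    T.IsDynAttack O :=
  ⟨fun _ hx => (mem_bas_sub.1 (h.subset_bas hx)).1, h.rel_mem, h.irrefl, h.trans⟩

theorem satisfiable_sub_iff (hT : T.IsAttackTree) {v : N} (hv : v ∈ T.nodes) :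
    (T.sub v).Satisfiable ↔ ∃ O, T.IsDynAttack O ∧ T.DynReaches O v := by
  simp only [Satisfiable, dynSuccessful_sub_iff hT hv]
  exact ⟨fun ⟨O, h, h'⟩ => ⟨O, h.of_sub, h'⟩, fun ⟨O, h, h'⟩ => ⟨_, h.restrict v, h'.restrict⟩⟩

theorem IsRoot.dynSuccessful_iff (hT : T.IsAttackTree) {r : N} (hr : T.IsRoot r) {O : Attack N} :
    T.DynSuccessful O ↔ T.IsDynAttack O ∧ T.DynReaches O r := by
  refine and_congr_right fun _ => ⟨fun ⟨r', hr', h⟩ => ?_, fun h => ⟨r, hr, h⟩⟩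
  rwa [hT.unique_root.unique hr hr']

theorem mem_dynMinAttacks {O : Attack N} :
    O ∈ T.dynMinAttacks ↔ Minimal T.DynSuccessful O := by
  simp only [dynMinAttacks, Finset.mem_filter, Finset.mem_product, Finset.mem_powerset,
    and_iff_right_iff_imp]
  intro h
  refine ⟨h.1.1.subset_bas, ?_⟩
  rintro ⟨x, y⟩ hxy
  obtain ⟨hx, hy⟩ := h.1.1.rel_mem _ _ hxy
  exact Finset.mem_product.2 ⟨h.1.1.subset_bas hx, h.1.1.subset_bas hy⟩

theorem DynSuccessful.exists_minimal_le {O : Attack N} (h : T.DynSuccessful O) :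
    ∃ O' ≤ O, O' ∈ T.dynMinAttacks := by
  have hfin : {Q | T.DynSuccessful Q ∧ Q ≤ O}.Finite :=
    (O.1.powerset ×ˢ O.2.powerset).finite_toSet.subset fun _ h => Finset.mem_coe.2 <|
      Finset.mem_product.2 ⟨Finset.mem_powerset.2 h.2.1, Finset.mem_powerset.2 h.2.2⟩
  obtain ⟨Q, hQ, hmin⟩ := hfin.exists_le_minimal ⟨h, le_rfl⟩
  refine ⟨Q, hQ, mem_dynMinAttacks.2 ⟨hmin.1.1, fun R hR hle => hmin.2 ⟨hR, hle.trans hQ⟩ hle⟩⟩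

/-! ### Attacks on a tree with a module -/

theorem IsModule.mem_bas_contract {v : N} (hv : T.IsModule v) {x : N} :
    x ∈ (T.contract v).bas ↔ x = v ∨ x ∈ T.bas ∧ ¬ T.Desc v x := by
  rw [mem_bas, mem_nodes_contract, mem_bas]
  by_cases h : x = v
  · subst h; simp [hv.1]
  · rw [typ_contract h]; tauto

theorem IsModule.substitutable {v : N} (hT : T.IsAttackTree) (hv : T.IsModule v) {O P : Attack N}
    (hO : (T.contract v).IsDynAttack O) (hP : (T.sub v).DynSuccessful P) :
    Substitutable v O P := by
  obtain ⟨hP, hr⟩ := (dynSuccessful_sub_iff hT hv.1).1 hP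
  have h : ∀ x ∈ P.1, x ∈ T.bas ∧ T.Desc v x := fun x hx => mem_bas_sub.1 (hP.subset_bas hx)
  have hvP : v ∉ P.1 := fun h' => hv.2.1 (mem_bas.1 (h v h').1).2
  refine ⟨hO.isOrderedSet, hP.isOrderedSet, ?_, hvP, fun x hx hx' => ?_⟩
  · obtain ⟨a, ha, -⟩ := hr.nonempty hT hv.1
    exact ⟨a, ha⟩
  · rcases hv.mem_bas_contract.1 (hO.subset_bas hx') with rfl | h'
    · exact hvP hx
    · exact h'.2 (h x hx).2

theorem IsModule.isDynAttack_subst {v : N} (hT : T.IsAttackTree) (hv : T.IsModule v)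
    {O P : Attack N} (hO : (T.contract v).IsDynAttack O) (hP : (T.sub v).DynSuccessful P) :
    T.IsDynAttack (substAttack v O P) := by
  have h := (hv.substitutable hT hO hP).subst_isOrderedSet
  refine ⟨fun x hx => ?_, h.rel_mem, h.irrefl, h.trans⟩
  rw [mem_substAttack_fst] at hx
  rcases hx with ⟨hxv, ⟨h1, -⟩ | ⟨-, h1⟩⟩
  · exact (mem_bas_sub.1 (hP.1.subset_bas h1)).1
  · exact ((hv.mem_bas_contract.1 (hO.subset_bas h1)).resolve_left hxv).1

/-- A substituted attack reaches the same nodes outside of the module. -/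
theorem IsModule.dynReaches_subst {v : N} (hT : T.IsAttackTree) (hv : T.IsModule v)
    {O P : Attack N} (hO : (T.contract v).IsDynAttack O) (hP : (T.sub v).DynSuccessful P)
    {x : N} (hx : x ∈ (T.contract v).nodes) (h : (T.contract v).DynReaches O x) :
    T.DynReaches (substAttack v O P) x := by
  have hPd : ∀ a ∈ P.1, T.Desc v a := fun a ha => (mem_bas_sub.1 (hP.1.subset_bas ha)).2
  have hne : ∀ {x}, (T.contract v).typ x ≠ NodeType.BAS → x ≠ v := by
    rintro x h rfl; exact h typ_contract_self
  induction h with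
  | bas x h1 h2 =>
    by_cases hxv : x = v
    · subst hxv
      refine ((dynSuccessful_sub_iff hT hv.1).1 hP).2.transfer (fun _ _ => ⟨rfl, rfl⟩) ?_ ?_
      · intro y hy
        rw [mem_substAttack_fst]
        constructor
        · intro h; exact ⟨fun e => (hv.substitutable hT hO hP).notMem (e ▸ h), .inl ⟨h, h2⟩⟩
        · rintro ⟨hyv, ⟨h, -⟩ | ⟨-, h⟩⟩
          · exact h
          · exact absurd hy ((hv.mem_bas_contract.1 (hO.subset_bas h)).resolve_left hyv).2
      · intro a b _ _ hab
        have hm := hP.1.rel_mem _ _ hab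
        have hn := (hv.substitutable hT hO hP).notMem
        exact mem_substAttack_snd.2 ⟨mem_substAttack_fst.2 ⟨fun e => hn (e ▸ hm.1),
          .inl ⟨hm.1, h2⟩⟩, mem_substAttack_fst.2 ⟨fun e => hn (e ▸ hm.2), .inl ⟨hm.2, h2⟩⟩,
          .inl hab⟩
    · refine .bas x (by rwa [typ_contract hxv] at h1) (mem_substAttack_fst.2 ⟨hxv, .inr ⟨?_, h2⟩⟩)
      exact fun h => (hv.substitutable hT hO hP).disjoint x h h2
  | or x u h1 h2 h3 ih =>
    have hxv : x ≠ v := hne (by simp [h1])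
    rw [typ_contract hxv] at h1
    rw [ch_contract hxv] at h2
    exact .or x u h1 h2 (ih (hv.ch_mem_contract hT hx hxv h2))
  | and x h1 h2 ih =>
    have hxv : x ≠ v := hne (by simp [h1])
    rw [typ_contract hxv] at h1
    rw [ch_contract hxv] at ih
    exact .and x h1 fun u hu => ih u hu (hv.ch_mem_contract hT hx hxv hu)
  | sand x h1 h2 h3 ih =>
    have hxv : x ≠ v := hne (by simp [h1])
    rw [typ_contract hxv] at h1
    rw [ch_contract hxv] at ih h3
    refine .sand x h1 (fun u hu => ih u hu (hv.ch_mem_contract hT hx hxv hu)) ?_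
    -- An attacked step of the module lies below `c` only along a path that enters the module at
    -- `v`, so its collapse `v` also lies below `c`.
    have key : ∀ c ∈ T.ch x, ∀ a ∈ (substAttack v O P).1, T.Desc c a →
        (T.contract v).Desc c (collapseMap v (· ∈ P.1) a) := by
      intro c hc a ha hca
      have hcT := hv.ch_mem_contract hT hx hxv hc
      have haT := (mem_bas.1 (hO.subset_bas (collapseMap_mem_of_mem_subst ha))).1
      rw [desc_contract_iff hT hcT haT]
      by_cases haP : a ∈ P.1
      · rw [collapseMap_pos (p := (· ∈ P.1)) haP]
        by_cases hvc : T.Desc v c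
        · rw [(mem_nodes_contract.1 hcT).2 hvc]; exact .refl
        · exact hv.desc_of_desc hT (mem_nodes_contract.1 hcT).1 hca hvc (hPd a haP)
      · rwa [collapseMap_neg (p := (· ∈ P.1)) haP]
    intro i c c' hc hc' a ha a' ha' hca hca'
    exact mem_substAttack_snd.2 ⟨ha, ha', .inr (h3 i c c' hc hc' _
      (collapseMap_mem_of_mem_subst ha) _ (collapseMap_mem_of_mem_subst ha')
      (key c (List.mem_of_getElem? hc) a ha hca) (key c' (List.mem_of_getElem? hc') a' ha' hca'))⟩

/-! ### Collapsing attacks onto the contraction -/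

open scoped Classical in
/-- The image of an attack on `T` in `T.contract v`: the part below `v` is collapsed to the single
step `v` if it reaches `v`, and is dropped otherwise. -/
noncomputable def collapseAttack (T : AttackTree N) (v : N) (O : Attack N) : Attack N :=
  let A := (insert v O.1).filter fun x => if T.Desc v x then x = v ∧ T.DynReaches O v else x ∈ O.1
  (A, (A ×ˢ A).filter fun x => ∀ a ∈ O.1, ∀ b ∈ O.1,
    collapseMap v (T.Desc v) a = x.1 → collapseMap v (T.Desc v) b = x.2 → (a, b) ∈ O.2)

theorem mem_collapseAttack_fst {v : N} {O : Attack N} {x : N} :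
    x ∈ (T.collapseAttack v O).1 ↔ x = v ∧ T.DynReaches O v ∨ ¬ T.Desc v x ∧ x ∈ O.1 := by
  simp only [collapseAttack, Finset.mem_filter, Finset.mem_insert]
  by_cases h : T.Desc v x
  · simp only [h, if_true, not_true, false_and, or_false]; tauto
  · have : x ≠ v := fun e => h (e ▸ .refl)
    simp [h, this]

theorem mem_collapseAttack_snd {v : N} {O : Attack N} {x y : N} :
    (x, y) ∈ (T.collapseAttack v O).2 ↔
      x ∈ (T.collapseAttack v O).1 ∧ y ∈ (T.collapseAttack v O).1 ∧
      ∀ a ∈ O.1, ∀ b ∈ O.1,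
        collapseMap v (T.Desc v) a = x → collapseMap v (T.Desc v) b = y → (a, b) ∈ O.2 := by
  simp only [collapseAttack, Finset.mem_filter, Finset.mem_product, and_assoc]

/-- The collapsed order quantifies over all preimages. Their existence rules out vacuous relations
and yields irreflexivity and transitivity. -/
theorem exists_of_mem_collapseAttack {v : N} (hT : T.IsAttackTree) (hv : v ∈ T.nodes)
    {O : Attack N} {x : N} (hx : x ∈ (T.collapseAttack v O).1) :
    ∃ a ∈ O.1, collapseMap v (T.Desc v) a = x := by
  rcases mem_collapseAttack_fst.1 hx with ⟨rfl, h⟩ | ⟨h, h'⟩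
  · obtain ⟨a, ha, hd⟩ := h.nonempty hT hv
    exact ⟨a, ha, collapseMap_pos hd⟩
  · exact ⟨x, h', collapseMap_neg h⟩

theorem IsModule.isDynAttack_collapse {v : N} (hT : T.IsAttackTree) (hv : T.IsModule v)
    {O : Attack N} (hO : T.IsDynAttack O) : (T.contract v).IsDynAttack (T.collapseAttack v O) := by
  constructor
  · intro x hx
    rw [mem_collapseAttack_fst] at hx
    rw [hv.mem_bas_contract]
    rcases hx with ⟨h, -⟩ | ⟨h, h'⟩
    · exact .inl h
    · exact .inr ⟨hO.subset_bas h', h⟩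
  · intro a b hab
    rw [mem_collapseAttack_snd] at hab
    exact ⟨hab.1, hab.2.1⟩
  · intro x hx
    rw [mem_collapseAttack_snd] at hx
    obtain ⟨a, ha, h⟩ := exists_of_mem_collapseAttack hT hv.1 hx.1
    exact hO.irrefl a (hx.2.2 a ha a ha h h)
  · intro x y z hxy hyz
    rw [mem_collapseAttack_snd] at hxy hyz ⊢
    refine ⟨hxy.1, hyz.2.1, fun a ha c hc hax hcz => ?_⟩
    obtain ⟨b, hb, h⟩ := exists_of_mem_collapseAttack hT hv.1 hxy.2.1
    exact hO.trans _ _ _ (hxy.2.2 a ha b hb hax h) (hyz.2.2 b hb c hc h hcz)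

/-- A collapsed attack reaches the same nodes outside of the module. -/
theorem IsModule.dynReaches_collapse {v : N} (hT : T.IsAttackTree) (hv : T.IsModule v)
    {O : Attack N} {x : N} (hx : x ∈ (T.contract v).nodes)
    (h : T.DynReaches O x) : (T.contract v).DynReaches (T.collapseAttack v O) x := by
  by_cases hxv : x = v
  · subst hxv
    exact .bas x typ_contract_self (mem_collapseAttack_fst.2 (.inl ⟨rfl, h⟩))
  have step : ∀ {x u}, x ∈ (T.contract v).nodes → x ≠ v → u ∈ T.ch x → T.DynReaches O u →
      (u ∈ (T.contract v).nodes → u ≠ v → (T.contract v).DynReaches (T.collapseAttack v O) u) →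
      (T.contract v).DynReaches (T.collapseAttack v O) u := by
    intro x u hx hxv hu h ih
    by_cases huv : u = v
    · subst huv
      exact .bas u typ_contract_self (mem_collapseAttack_fst.2 (.inl ⟨rfl, h⟩))
    · exact ih (hv.ch_mem_contract hT hx hxv hu) huv
  induction h with
  | bas x h1 h2 =>
    refine .bas x (by rwa [typ_contract hxv]) (mem_collapseAttack_fst.2 (.inr ⟨fun h => ?_, h2⟩))
    exact hxv ((mem_nodes_contract.1 hx).2 h)
  | or x u h1 h2 h3 ih =>
    exact .or x u (by rwa [typ_contract hxv]) (by rwa [ch_contract hxv]) (step hx hxv h2 h3 ih)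
  | and x h1 h2 ih =>
    refine .and x (by rwa [typ_contract hxv]) ?_
    rw [ch_contract hxv]
    exact fun u hu => step hx hxv hu (h2 u hu) (ih u hu)
  | sand x h1 h2 h3 ih =>
    refine .sand x (by rwa [typ_contract hxv]) ?_ ?_
    · rw [ch_contract hxv]
      exact fun u hu => step hx hxv hu (h2 u hu) (ih u hu)
    · rw [ch_contract hxv]
      intro i c c' hc hc' a ha a' ha' hca hca'
      refine mem_collapseAttack_snd.2 ⟨ha, ha', fun b hb b' hb' hba hba' => ?_⟩
      -- Being below `c` after the collapse implies being below `c` before it, so every pair of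
      -- preimages falls under the original sequential constraint.
      have key : ∀ {a b c}, (T.contract v).Desc c a → collapseMap v (T.Desc v) b = a →
          T.Desc c b := by
        intro a b c hca hb
        refine (desc_of_contract hca).trans ?_
        by_cases hd : T.Desc v b
        · rw [collapseMap_pos hd] at hb; exact hb ▸ hd
        · rw [collapseMap_neg hd] at hb; exact hb ▸ .refl
      exact h3 i c c' hc hc' b hb b' hb' (key hca hba) (key hca' hba')

/-- Substituting a suitable attack into the collapse of `O` gives an attack below `O`. -/
theorem subst_collapse_le {v : N} {O P : Attack N} (hP : (T.sub v).IsDynAttack P)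
    (h : T.DynReaches O v → P ≤ T.restrictAttack v O) :
    substAttack v (T.collapseAttack v O) P ≤ O := by
  have hPd : ∀ a ∈ P.1, T.Desc v a := fun a ha => (mem_bas_sub.1 (hP.subset_bas ha)).2
  -- On the substituted attack, collapsing everything below `v` and collapsing only `P` have the
  -- same effect.
  have h1 : ∀ x ∈ (substAttack v (T.collapseAttack v O) P).1, x ∈ O.1 ∧
      collapseMap v (T.Desc v) x = collapseMap v (· ∈ P.1) x ∧
      (x ∈ P.1 → T.DynReaches O v) := by
    intro x hx
    rw [mem_substAttack_fst, mem_collapseAttack_fst, mem_collapseAttack_fst] at hx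
    rcases hx with ⟨hxv, ⟨h1, h2⟩ | ⟨h1, h2⟩⟩
    · rw [collapseMap_pos (p := (· ∈ P.1)) h1, collapseMap_pos (hPd x h1)]
      have h3 : T.DynReaches O v := by
        rcases h2 with h2 | h2
        · exact h2.2
        · exact absurd .refl h2.1
      exact ⟨(mem_restrictAttack_fst.1 ((h h3).1 h1)).1, rfl, fun _ => h3⟩
    · have h2 := h2.resolve_left fun h => hxv h.1
      rw [collapseMap_neg (p := (· ∈ P.1)) h1, collapseMap_neg h2.1]
      exact ⟨h2.2, rfl, fun h => absurd h h1⟩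
  refine ⟨fun x hx => (h1 x hx).1, ?_⟩
  rintro ⟨x, y⟩ hxy
  rw [mem_substAttack_snd] at hxy
  obtain ⟨hx, hy, hxy | hxy⟩ := hxy
  · have := (h1 x hx).2.2 (hP.rel_mem _ _ hxy).1
    exact (mem_restrictAttack_snd.1 ((h this).2 hxy)).1
  · rw [mem_collapseAttack_snd] at hxy
    exact hxy.2.2 x (h1 x hx).1 y (h1 y hy).1 (h1 x hx).2.1 (h1 y hy).2.1

/-! ### Minimal attacks as substitutions -/

theorem IsModule.dynSuccessful_subst {v : N} (hT : T.IsAttackTree) (hv : T.IsModule v)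
    {O P : Attack N} (hO : (T.contract v).DynSuccessful O) (hP : (T.sub v).DynSuccessful P) :
    T.DynSuccessful (substAttack v O P) := by
  obtain ⟨hO, r, hr, h⟩ := hO
  exact ⟨hv.isDynAttack_subst hT hO hP, r, (hv.isRoot_contract_iff hT).1 hr,
    hv.dynReaches_subst hT hO hP hr.1 h⟩

theorem IsModule.dynSuccessful_collapse {v : N} (hT : T.IsAttackTree) (hv : T.IsModule v)
    {O : Attack N} (hO : T.DynSuccessful O) :
    (T.contract v).DynSuccessful (T.collapseAttack v O) := by
  obtain ⟨hO, r, hr, h⟩ := hO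
  have hr := (hv.isRoot_contract_iff hT).2 hr
  exact ⟨hv.isDynAttack_collapse hT hO, r, hr, hv.dynReaches_collapse hT hr.1 h⟩

/-- A collapsed attack still reaches every surviving node it reached, not only the root; hence the
remaining modules stay satisfiable. -/
theorem satisfiable_sub_contract {v x : N} (hT : T.IsAttackTree) (hv : T.IsModule v)
    (hx : x ∈ (T.contract v).nodes) (h : (T.sub x).Satisfiable) :
    ((T.contract v).sub x).Satisfiable := by
  obtain ⟨O, hO, hr⟩ := (satisfiable_sub_iff hT (mem_nodes_contract.1 hx).1).1 h
  exact (satisfiable_sub_iff (hv.contract_isAttackTree hT) hx).2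
    ⟨_, hv.isDynAttack_collapse hT hO, hv.dynReaches_collapse hT hx hr⟩

theorem IsModule.disjoint_sub_contract {v : N} (hv : T.IsModule v) {O P : Attack N}
    (hO : (T.contract v).IsDynAttack O) (hP : (T.sub v).IsDynAttack P) :
    ∀ x ∈ P.1, x ∉ O.1 := by
  intro x hx hx'
  have h := mem_bas_sub.1 (hP.subset_bas hx)
  rcases hv.mem_bas_contract.1 (hO.subset_bas hx') with rfl | h'
  · exact hv.2.1 (mem_bas.1 h.1).2
  · exact h'.2 h.2

/-- Below every successful attack on `T` lies the substitution of a minimal successful attack on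
the module into a minimal successful attack on the contraction. -/
theorem IsModule.exists_subst_le {v : N} (hT : T.IsAttackTree) (hv : T.IsModule v)
    (hsat : (T.sub v).Satisfiable) {Q : Attack N} (hQ : T.DynSuccessful Q) :
    ∃ O ∈ (T.contract v).dynMinAttacks, ∃ P ∈ (T.sub v).dynMinAttacks, substAttack v O P ≤ Q := by
  -- If `Q` does not reach `v`, then `v` is absent from the collapse and any minimal `P` will do;
  -- satisfiability of the module supplies one.
  obtain ⟨P, hP, hle⟩ : ∃ P ∈ (T.sub v).dynMinAttacks,
      T.DynReaches Q v → P ≤ T.restrictAttack v Q := by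
    by_cases h : T.DynReaches Q v
    · obtain ⟨P, hle, hP⟩ := DynSuccessful.exists_minimal_le
        ((dynSuccessful_sub_iff hT hv.1).2 ⟨hQ.1.restrict v, h.restrict⟩)
      exact ⟨P, hP, fun _ => hle⟩
    · obtain ⟨P, -, hP⟩ := hsat.choose_spec.exists_minimal_le
      exact ⟨P, hP, fun h' => absurd h' h⟩
  obtain ⟨O, hle', hO⟩ := (hv.dynSuccessful_collapse hT hQ).exists_minimal_le
  have hP' := (mem_dynMinAttacks.1 hP).1
  refine ⟨O, hO, P, hP, le_trans ?_ (subst_collapse_le hP'.1 hle)⟩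
  exact substAttack_mono (hv.disjoint_sub_contract (mem_dynMinAttacks.1 hO).1.1 hP'.1) hle' le_rfl

/-- Order reflection yields inclusions between minimal attacks, and these are equalities. -/
theorem IsModule.le_of_subst_le {v : N} (hT : T.IsAttackTree) (hv : T.IsModule v)
    {O O' P P' : Attack N} (hO : O ∈ (T.contract v).dynMinAttacks)
    (hO' : O' ∈ (T.contract v).dynMinAttacks) (hP : P ∈ (T.sub v).dynMinAttacks)
    (hP' : P' ∈ (T.sub v).dynMinAttacks) (hle : substAttack v O P ≤ substAttack v O' P') :
    O = O' ∧ (v ∈ O.1 → P = P') := by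
  rw [mem_dynMinAttacks] at hO hO' hP hP'
  have h := le_of_substAttack_le (hv.substitutable hT hO.1.1 hP.1)
    (hv.substitutable hT hO'.1.1 hP'.1) (hv.disjoint_sub_contract hO'.1.1 hP.1.1)
    (hv.disjoint_sub_contract hO.1.1 hP'.1.1) hle
  exact ⟨hO'.eq_of_le hO.1 h.1, fun hvO => hP'.eq_of_le hP.1 (h.2 hvO)⟩

/-- A minimal `Q` equals the successful substitution found below it. Conversely, below any
successful `Q` under a substitution lies a second substitution, which order reflection identifies
with the first. -/
theorem IsModule.mem_dynMinAttacks_iff {v : N} (hT : T.IsAttackTree) (hv : T.IsModule v)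
    (hsat : (T.sub v).Satisfiable) {Q : Attack N} :
    Q ∈ T.dynMinAttacks ↔
      ∃ O ∈ (T.contract v).dynMinAttacks, ∃ P ∈ (T.sub v).dynMinAttacks, substAttack v O P = Q := by
  constructor
  · intro hQ
    rw [mem_dynMinAttacks] at hQ
    obtain ⟨O, hO, P, hP, hle⟩ := hv.exists_subst_le hT hsat hQ.1
    exact ⟨O, hO, P, hP, hQ.eq_of_le (hv.dynSuccessful_subst hT (mem_dynMinAttacks.1 hO).1
      (mem_dynMinAttacks.1 hP).1) hle⟩
  · rintro ⟨O, hO, P, hP, rfl⟩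
    have hO' := mem_dynMinAttacks.1 hO
    have hP' := mem_dynMinAttacks.1 hP
    refine mem_dynMinAttacks.2 ⟨hv.dynSuccessful_subst hT hO'.1 hP'.1, fun Q hQ hle => ?_⟩
    obtain ⟨O', hO₁, P', hP₁, hle'⟩ := hv.exists_subst_le hT hsat hQ
    obtain ⟨rfl, h⟩ := hv.le_of_subst_le hT hO₁ hO hP₁ hP (hle'.trans hle)
    by_cases hvO : v ∈ O'.1
    · rw [← h hvO]; exact hle'
    · rw [substAttack_of_notMem (hv.substitutable hT hO'.1.1 (mem_dynMinAttacks.1 hP₁).1) hvO]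
        at hle'
      rwa [substAttack_of_notMem (hv.substitutable hT hO'.1.1 hP'.1) hvO]

open scoped Classical in
/-- Aggregation over the minimal attacks of `T`, split along a module. -/
theorem IsModule.bigOp_dynMinAttacks {V : Type w} (op : V → V → V) [Std.Commutative op]
    [Std.Associative op] {v : N} (hT : T.IsAttackTree) (hv : T.IsModule v)
    (hsat : (T.sub v).Satisfiable) (W : Attack N → Option V) :
    bigOp op T.dynMinAttacks W = bigOp op (T.contract v).dynMinAttacks fun O =>
      if v ∈ O.1 then bigOp op (T.sub v).dynMinAttacks fun P => W (substAttack v O P) else W O := by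
  obtain ⟨P₀, -, hP₀⟩ := hsat.choose_spec.exists_minimal_le
  let t : Attack N → Finset (Attack N) := fun O =>
    if v ∈ O.1 then (T.sub v).dynMinAttacks else {P₀}
  have ht : ∀ O P, P ∈ t O → P ∈ (T.sub v).dynMinAttacks := by
    intro O P h
    by_cases hvO : v ∈ O.1
    · simpa [t, hvO] using h
    · simp only [t, hvO, if_false, Finset.mem_singleton] at h
      exact h ▸ hP₀
  have himg : T.dynMinAttacks =
      ((T.contract v).dynMinAttacks.sigma t).image fun x => substAttack v x.1 x.2 := by
    ext Q
    simp only [Finset.mem_image, Finset.mem_sigma, hv.mem_dynMinAttacks_iff hT hsat]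
    constructor
    · rintro ⟨O, hO, P, hP, rfl⟩
      by_cases hvO : v ∈ O.1
      · exact ⟨⟨O, P⟩, ⟨hO, by simpa [t, hvO] using hP⟩, rfl⟩
      · refine ⟨⟨O, P₀⟩, ⟨hO, by simp [t, hvO]⟩, ?_⟩
        have hO' := (mem_dynMinAttacks.1 hO).1.1
        rw [substAttack_of_notMem (hv.substitutable hT hO' (mem_dynMinAttacks.1 hP).1) hvO]
        exact substAttack_of_notMem (hv.substitutable hT hO' (mem_dynMinAttacks.1 hP₀).1) hvO
    · rintro ⟨⟨O, P⟩, ⟨hO, hP⟩, rfl⟩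
      exact ⟨O, hO, P, ht O P hP, rfl⟩
  rw [himg, bigOp_image, bigOp_sigma]
  · refine bigOp_congr op fun O hO => ?_
    by_cases hvO : v ∈ O.1
    · simp [t, hvO]
    · simp only [t, hvO, if_false, bigOp_singleton]
      rw [substAttack_of_notMem (hv.substitutable hT (mem_dynMinAttacks.1 hO).1.1
        (mem_dynMinAttacks.1 hP₀).1) hvO]
  · rintro ⟨O, P⟩ h ⟨O', P'⟩ h' heq
    simp only [Finset.mem_coe, Finset.mem_sigma] at h h' heq
    obtain ⟨rfl, h1⟩ := hv.le_of_subst_le hT h.1 h'.1 (ht _ _ h.2) (ht _ _ h'.2) heq.le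
    by_cases hvO : v ∈ O.1
    · rw [h1 hvO]
    · have h2 := h.2
      have h3 := h'.2
      simp only [t, hvO, if_false, Finset.mem_singleton] at h2 h3
      rw [h2, h3]

end AttackTree

/-! ### Maximal chains -/

section Chains

variable {N : Type u}

/-- `x` and `y` are equal or comparable in `O`. -/
def Comparable (O : Attack N) (x y : N) : Prop := x = y ∨ (x, y) ∈ O.2 ∨ (y, x) ∈ O.2

theorem Comparable.symm {O : Attack N} {x y : N} (h : Comparable O x y) : Comparable O y x := by
  rcases h with h | h | h
  · exact .inl h.symm
  · exact .inr (.inr h)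
  · exact .inr (.inl h)

/-- A chain is maximal when no outside point is comparable to all its members. This pointwise form
avoids quantifying over other chains. -/
theorem mem_maxChains {O : Attack N} {C : Finset N} :
    C ∈ maxChains O ↔ C ⊆ O.1 ∧ ∀ x ∈ O.1, x ∈ C ↔ ∀ c ∈ C, Comparable O c x := by
  classical
  simp only [maxChains, Finset.mem_filter, Finset.mem_powerset]
  have hchain : ∀ {C : Finset N}, IsChain (fun a b => (a, b) ∈ O.2) (C : Set N) ↔
      ∀ x ∈ C, ∀ y ∈ C, Comparable O x y := by
    intro C
    constructor
    · intro h x hx y hy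
      by_cases hxy : x = y
      · exact .inl hxy
      · exact .inr (h hx hy hxy)
    · intro h x hx y hy hxy
      exact (h x hx y hy).resolve_left hxy
  simp only [hchain]
  constructor
  · rintro ⟨h, hmax⟩
    refine ⟨h, fun x hx => ⟨fun hxC c hc => hmax.1.2 c hc x hxC, fun hall => ?_⟩⟩
    refine hmax.2 (y := insert x C) ⟨Finset.insert_subset hx h, ?_⟩ (Finset.subset_insert _ _)
      (Finset.mem_insert_self _ _)
    intro a ha b hb
    rcases Finset.mem_insert.1 ha with rfl | ha' <;> rcases Finset.mem_insert.1 hb with rfl | hb'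
    · exact .inl rfl
    · exact (hall b hb').symm
    · exact hall a ha'
    · exact hmax.1.2 a ha' b hb'
  · rintro ⟨h, h'⟩
    refine ⟨h, ⟨h, fun x hx y hy => (h' y (h hy)).1 hy x hx⟩, fun E hE hle x hx => ?_⟩
    exact (h' x (hE.1 hx)).2 fun c hc => hE.2 c (hle hc) x hx

theorem exists_mem_maxChains (O : Attack N) {x : N} (hx : x ∈ O.1) :
    ∃ C ∈ maxChains O, x ∈ C := by
  classical
  have hfin : {C : Finset N | C ⊆ O.1 ∧ IsChain (fun a b => (a, b) ∈ O.2) (C : Set N)}.Finite :=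
    O.1.powerset.finite_toSet.subset fun _ h => Finset.mem_coe.2 (Finset.mem_powerset.2 h.1)
  obtain ⟨C, hle, hC⟩ := hfin.exists_le_maximal (a := {x}) ⟨by simpa using hx, by simp⟩
  exact ⟨C, by simp only [maxChains, Finset.mem_filter, Finset.mem_powerset]; exact ⟨hC.1.1, hC⟩,
    hle (Finset.mem_singleton_self x)⟩

theorem nonempty_of_mem_maxChains {O : Attack N} (hO : O.1.Nonempty) {C : Finset N}
    (hC : C ∈ maxChains O) : C.Nonempty := by
  obtain ⟨a, ha⟩ := hO
  by_contra h
  rw [Finset.not_nonempty_iff_eq_empty] at h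
  subst h
  simpa using (mem_maxChains.1 hC).2 a ha

/-- In this case `v` is comparable only to itself. -/
theorem eq_singleton_of_mem_maxChains {O : Attack N} {v : N} (h : {v} ∈ maxChains O)
    {C : Finset N} (hC : C ∈ maxChains O) (hv : v ∈ C) : C = {v} := by
  rw [mem_maxChains] at h hC
  ext x
  constructor
  · intro hx
    rw [h.2 x (hC.1 hx)]
    intro c hc
    rw [Finset.mem_singleton.1 hc]
    exact (hC.2 x (hC.1 hx)).1 hx v hv
  · intro hx
    rwa [Finset.mem_singleton.1 hx]

variable {v : N} {O P : Attack N}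

/-- Seen from outside `P`, all elements of `P` look like `v`, since `P.2` relates only elements of
`P`. -/
theorem Substitutable.comparable_left (h : Substitutable v O P) {x y : N}
    (hx : x ∈ (substAttack v O P).1) (hy : y ∈ (substAttack v O P).1) (hxP : x ∉ P.1) :
    Comparable (substAttack v O P) x y ↔ Comparable O x (collapseMap v (· ∈ P.1) y) := by
  have h1 : (x, y) ∉ P.2 := fun h' => hxP (h.right.rel_mem _ _ h').1
  have h2 : (y, x) ∉ P.2 := fun h' => hxP (h.right.rel_mem _ _ h').2
  have h3 : x = y ↔ x = collapseMap v (· ∈ P.1) y := by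
    by_cases hyP : y ∈ P.1
    · rw [collapseMap_pos (p := (· ∈ P.1)) hyP]
      exact ⟨fun e => absurd hyP (e ▸ hxP), fun e => absurd e (mem_substAttack_fst.1 hx).1⟩
    · rw [collapseMap_neg (p := (· ∈ P.1)) hyP]
  simp only [Comparable, mem_substAttack_snd, hx, hy, h1, h2, true_and, false_or, ← h3,
    collapseMap_neg (p := (· ∈ P.1)) hxP]

theorem Substitutable.comparable_right (h : Substitutable v O P) {x y : N}
    (hx : x ∈ (substAttack v O P).1) (hy : y ∈ (substAttack v O P).1) (hxP : x ∈ P.1)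
    (hyP : y ∈ P.1) : Comparable (substAttack v O P) x y ↔ Comparable P x y := by
  simp only [Comparable, mem_substAttack_snd, hx, hy, true_and, h.left.irrefl v, or_false,
    collapseMap_pos (p := (· ∈ P.1)) hxP, collapseMap_pos (p := (· ∈ P.1)) hyP]

theorem Substitutable.mem_of_mem (h : Substitutable v O P) (hv : v ∈ O.1) {x : N}
    (hx : x ∈ P.1) : x ∈ (substAttack v O P).1 :=
  mem_substAttack_fst.2 ⟨fun e => h.notMem (e ▸ hx), .inl ⟨hx, hv⟩⟩

theorem Substitutable.mem_of_ne (h : Substitutable v O P) {x : N}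
    (hx : x ∈ O.1) (hxv : x ≠ v) : x ∈ (substAttack v O P).1 ∧ x ∉ P.1 :=
  have h' : x ∉ P.1 := fun h' => h.disjoint x h' hx
  ⟨mem_substAttack_fst.2 ⟨hxv, .inr ⟨h', hx⟩⟩, h'⟩

theorem mem_of_mem_subst {x : N} (hx : x ∈ (substAttack v O P).1) (hxP : x ∉ P.1) :
    x ∈ O.1 ∧ x ≠ v := by
  rw [mem_substAttack_fst] at hx; tauto

open scoped Classical in
/-- The maximal chains of a substituted attack. -/
theorem Substitutable.maxChains_subst (h : Substitutable v O P) (hv : v ∈ O.1) :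
    maxChains (substAttack v O P) = ((maxChains O).filter (v ∉ ·)) ∪
      (((maxChains O).filter (v ∈ ·)) ×ˢ maxChains P).image fun x => x.1.erase v ∪ x.2 := by
  -- In these four comparison rules, `N` stands for a point of `O` other than `v`, and `P` for a
  -- point of `P`.
  have cNN : ∀ {x y}, x ∈ O.1 → x ≠ v → y ∈ O.1 → y ≠ v →
      (Comparable (substAttack v O P) x y ↔ Comparable O x y) := by
    intro x y hx hxv hy hyv
    have hx' := h.mem_of_ne hx hxv
    have hy' := h.mem_of_ne hy hyv
    rw [h.comparable_left hx'.1 hy'.1 hx'.2, collapseMap_neg (p := (· ∈ P.1)) hy'.2]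
  have cNP : ∀ {x y}, x ∈ O.1 → x ≠ v → y ∈ P.1 →
      (Comparable (substAttack v O P) x y ↔ Comparable O x v) := by
    intro x y hx hxv hy
    have hx' := h.mem_of_ne hx hxv
    rw [h.comparable_left hx'.1 (h.mem_of_mem hv hy) hx'.2,
      collapseMap_pos (p := (· ∈ P.1)) hy]
  have cPN : ∀ {x y}, x ∈ P.1 → y ∈ O.1 → y ≠ v →
      (Comparable (substAttack v O P) x y ↔ Comparable O v y) := by
    intro x y hx hy hyv
    exact ⟨fun h' => ((cNP hy hyv hx).1 h'.symm).symm, fun h' => ((cNP hy hyv hx).2 h'.symm).symm⟩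
  have cPP : ∀ {x y}, x ∈ P.1 → y ∈ P.1 →
      (Comparable (substAttack v O P) x y ↔ Comparable P x y) := fun hx hy =>
    h.comparable_right (h.mem_of_mem hv hx) (h.mem_of_mem hv hy) hx hy
  have crefl : ∀ x, Comparable O x x := fun x => .inl rfl
  obtain ⟨b₀, hb₀⟩ := h.nonempty
  have hdisj := h.disjoint
  ext C
  simp only [Finset.mem_union, Finset.mem_filter, Finset.mem_image, Finset.mem_product,
    Prod.exists]
  constructor
  · intro hC
    rw [mem_maxChains] at hC
    obtain ⟨hsub, hC⟩ := hC
    by_cases hE : ∃ b ∈ C, b ∈ P.1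
    · right
      obtain ⟨b, hbC, hbP⟩ := hE
      have hvC : ∀ c ∈ C, c ∉ P.1 → Comparable O c v := fun c hc hcP => by
        obtain ⟨h1, h2⟩ := mem_of_mem_subst (hsub hc) hcP
        exact (cNP h1 h2 hbP).1 ((hC b (hsub hbC)).1 hbC c hc)
      refine ⟨insert v (C.filter (· ∉ P.1)), C.filter (· ∈ P.1),
        ⟨⟨mem_maxChains.2 ⟨?_, fun x hx => ?_⟩, by simp⟩, mem_maxChains.2 ⟨?_, fun x hx => ?_⟩⟩, ?_⟩
      · intro x hx
        simp only [Finset.mem_insert, Finset.mem_filter] at hx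
        rcases hx with rfl | hx
        · exact hv
        · exact (mem_of_mem_subst (hsub hx.1) hx.2).1
      · simp only [Finset.mem_insert, Finset.mem_filter, forall_eq_or_imp, and_imp]
        by_cases hxv : x = v
        · subst hxv
          simp only [true_or, true_iff]
          exact ⟨crefl x, hvC⟩
        · obtain ⟨hxQ, hxP⟩ := h.mem_of_ne hx hxv
          simp only [hxv, false_or, hxP, not_false_eq_true, and_true, hC x hxQ]
          constructor
          · intro hall
            refine ⟨(cPN hbP hx hxv).1 (hall b hbC), fun c hc hcP => ?_⟩
            obtain ⟨h1, h2⟩ := mem_of_mem_subst (hsub hc) hcP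
            exact (cNN h1 h2 hx hxv).1 (hall c hc)
          · rintro ⟨h1, h2⟩ c hc
            by_cases hcP : c ∈ P.1
            · exact (cPN hcP hx hxv).2 h1
            · obtain ⟨h3, h4⟩ := mem_of_mem_subst (hsub hc) hcP
              exact (cNN h3 h4 hx hxv).2 (h2 c hc hcP)
      · exact fun x hx => (Finset.mem_filter.1 hx).2
      · simp only [Finset.mem_filter, hx, and_true, hC x (h.mem_of_mem hv hx), and_imp]
        constructor
        · intro hall c hc hcP
          exact (cPP hcP hx).1 (hall c hc)
        · intro hall c hc
          by_cases hcP : c ∈ P.1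
          · exact (cPP hcP hx).2 (hall c hc hcP)
          · obtain ⟨h3, h4⟩ := mem_of_mem_subst (hsub hc) hcP
            exact (cNP h3 h4 hx).2 (hvC c hc hcP)
      · ext x
        simp only [Finset.mem_union, Finset.mem_erase, Finset.mem_insert, Finset.mem_filter]
        by_cases hx : x ∈ C
        · have := (mem_substAttack_fst.1 (hsub hx)).1
          tauto
        · tauto
    · left
      push Not at hE
      have hCO : ∀ c ∈ C, c ∈ O.1 ∧ c ≠ v := fun c hc => mem_of_mem_subst (hsub hc) (hE c hc)
      have hvC : v ∉ C := fun h' => (hCO v h').2 rfl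
      refine ⟨mem_maxChains.2 ⟨fun c hc => (hCO c hc).1, fun x hx => ?_⟩, hvC⟩
      by_cases hxv : x = v
      · subst hxv
        refine ⟨fun h' => absurd h' hvC, fun hall => ?_⟩
        -- If `v` were comparable to all of `C`, so would be `b₀`; maximality would put `b₀` into
        -- `C`, which avoids `P`.
        refine absurd hb₀ (hE b₀ ((hC b₀ (h.mem_of_mem hv hb₀)).2 fun c hc => ?_))
        exact (cNP (hCO c hc).1 (hCO c hc).2 hb₀).2 (hall c hc)
      · rw [hC x (h.mem_of_ne hx hxv).1]
        exact forall₂_congr fun c hc => cNN (hCO c hc).1 (hCO c hc).2 hx hxv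
  · rintro (⟨hC, hvC⟩ | ⟨C, K, ⟨⟨hC, hvC⟩, hK⟩, rfl⟩)
    · rw [mem_maxChains] at hC ⊢
      obtain ⟨hsub, hC⟩ := hC
      have hne : ∀ c ∈ C, c ≠ v := fun c hc e => hvC (e ▸ hc)
      refine ⟨fun x hx => (h.mem_of_ne (hsub hx) (hne x hx)).1, fun x hx => ?_⟩
      by_cases hxP : x ∈ P.1
      · refine ⟨fun h' => absurd (hsub h') (hdisj x hxP), fun hall => ?_⟩
        refine absurd ((hC v hv).2 fun c hc => ?_) hvC
        exact (cNP (hsub hc) (hne c hc) hxP).1 (hall c hc)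
      · obtain ⟨h1, h2⟩ := mem_of_mem_subst hx hxP
        rw [hC x h1]
        exact forall₂_congr fun c hc => (cNN (hsub hc) (hne c hc) h1 h2).symm
    · have hKne := nonempty_of_mem_maxChains h.nonempty hK
      rw [mem_maxChains] at hC hK ⊢
      obtain ⟨hsub, hC⟩ := hC
      obtain ⟨hKsub, hK⟩ := hK
      obtain ⟨k₀, hk₀⟩ := hKne
      refine ⟨fun x hx => ?_, fun x hx => ?_⟩
      · rcases Finset.mem_union.1 hx with hx | hx
        · obtain ⟨h1, h2⟩ := Finset.mem_erase.1 hx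
          exact (h.mem_of_ne (hsub h2) h1).1
        · exact h.mem_of_mem hv (hKsub hx)
      · simp only [Finset.mem_union, Finset.mem_erase]
        by_cases hxP : x ∈ P.1
        · have hxC : x ∉ C := fun h' => hdisj x hxP (hsub h')
          simp only [hxC, and_false, false_or, hK x hxP]
          constructor
          · rintro hall c (⟨h1, h2⟩ | h1)
            · exact (cNP (hsub h2) h1 hxP).2 ((hC v hv).1 hvC c h2)
            · exact (cPP (hKsub h1) hxP).2 (hall c h1)
          · intro hall c hc
            exact (cPP (hKsub hc) hxP).1 (hall c (.inr hc))
        · obtain ⟨h1, h2⟩ := mem_of_mem_subst hx hxP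
          have hxK : x ∉ K := fun h' => hxP (hKsub h')
          simp only [hxK, or_false, h2, ne_eq, not_false_eq_true, true_and, hC x h1]
          constructor
          · rintro hall c (⟨h3, h4⟩ | h3)
            · exact (cNN (hsub h4) h3 h1 h2).2 (hall c h4)
            · exact (cPN (hKsub h3) h1 h2).2 (hall v hvC)
          · intro hall c hc
            by_cases hcv : c = v
            · subst hcv
              exact (cPN (hKsub hk₀) h1 h2).1 (hall k₀ (.inr hk₀))
            · exact (cNN (hsub hc) hcv h1 h2).1 (hall c (.inl ⟨hcv, hc⟩))

end Chains

/-! ### Values of attacks -/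

section Weights

variable {N : Type u} {V : Type w}

/-- The value of an attack in the dynamic metric. -/
noncomputable def dynWeight (D : SemiringDynDomain V) (α : N → V) (O : Attack N) : Option V :=
  bigOp D.conj (maxChains O) fun C => bigOp D.seq C fun a => some (α a)

/-- The value of an attack in the static metric. -/
noncomputable def staticWeight (D : SemiringDomain V) (α : N → V) (O : Attack N) : Option V :=
  bigOp D.conj O.1 fun a => some (α a)

theorem dynWeight_isSome (D : SemiringDynDomain V) (α : N → V) {O : Attack N}
    (hO : O.1.Nonempty) : (dynWeight D α O).isSome := by
  obtain ⟨a, ha⟩ := hO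
  obtain ⟨C, hC, -⟩ := exists_mem_maxChains O ha
  exact bigOp_isSome _ ⟨C, hC⟩ fun K hK =>
    bigOp_isSome _ (nonempty_of_mem_maxChains ⟨a, ha⟩ hK) fun _ _ => rfl

open scoped Classical in
/-- The conditions on the value of attacks under which modular analysis is correct: the value
depends only on the attributes of the elements, the value of a single step is its attribute, and
disjunctions may be pulled out of substitutions. -/
structure IsModularWeight (D : SemiringDomain V) (W : (N → V) → Attack N → Option V) : Prop where
  congr : ∀ α β O, (∀ a ∈ O.1, α a = β a) → W α O = W β O
  singleton : ∀ α a, W α ({a}, ∅) = some (α a)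
  subst : ∀ α v O m (S : Finset (Attack N)), v ∈ O.1 → S.Nonempty →
    (∀ P ∈ S, Substitutable v O P) → bigOp D.disj S (W α) = some m →
    W (Function.update α v m) O = bigOp D.disj S fun P => W α (substAttack v O P)

-- Splitting off `v` writes the value of `O` as a conjunction with `m`, which distributes over the
-- disjunction defining `m`. The elements of a substitution are the disjoint union of `O.1.erase v`
-- and `P.1`.
open scoped Classical in
theorem staticWeight_isModularWeight (D : SemiringDomain V) :
    IsModularWeight (N := N) D (staticWeight D) where
  congr α β O h := bigOp_congr _ fun a ha => by rw [h a ha]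
  singleton α a := bigOp_singleton _ _ _
  subst α v O m S hv hS h hm := by
    have h1 : staticWeight D (Function.update α v m) O =
        Option.merge D.conj (bigOp D.conj (O.1.erase v) fun a => some (α a)) (some m) := by
      rw [staticWeight, ← Finset.insert_erase hv, bigOp_insert _ (Finset.notMem_erase v O.1),
        merge_comm, Finset.erase_insert (Finset.notMem_erase v O.1), Function.update_self]
      congr 1
      exact bigOp_congr _ fun a ha => by rw [Function.update_of_ne (Finset.ne_of_mem_erase ha)]
    rw [h1, ← hm, merge_bigOp _ D.conj_disj hS (f := staticWeight D α)
      fun P hP => bigOp_isSome _ (h P hP).nonempty fun _ _ => rfl]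
    refine bigOp_congr _ fun P hP => ?_
    have hdisj := (h P hP).disjoint
    have hnot := (h P hP).notMem
    rw [staticWeight, staticWeight, ← bigOp_union]
    · congr 1
      ext x
      rw [mem_substAttack_fst, Finset.mem_union, Finset.mem_erase]
      have := hdisj x
      by_cases hx : x = v
      · subst hx; simp [hnot]
      · simp only [hv]; tauto
    · exact Finset.disjoint_left.2 fun x hx hx' => hdisj x hx' (Finset.mem_of_mem_erase hx)

theorem maxChains_singleton (a : N) : maxChains (({a}, ∅) : Attack N) = {{a}} := by
  ext C
  rw [mem_maxChains, Finset.mem_singleton]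
  constructor
  · rintro ⟨h1, h2⟩
    refine Finset.Subset.antisymm h1 fun x hx => (h2 x hx).2 fun c hc => .inl ?_
    rw [Finset.mem_singleton.1 (h1 hc), Finset.mem_singleton.1 hx]
  · rintro rfl
    simp [Comparable]

open scoped Classical in
/-- Sequential composition with a defined value may be pulled out of the conjunction over the
maximal chains through a given element. -/
theorem bigOp_maxChains_through (D : SemiringDynDomain V) (α : N → V) (O : Attack N) (v : N)
    (hv : v ∈ O.1) (y : Option V) :
    (bigOp D.conj ((maxChains O).filter (v ∈ ·)) fun C =>
      Option.merge D.seq (bigOp D.seq (C.erase v) fun a => some (α a)) y) =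
    Option.merge D.seq (bigOp D.conj ((maxChains O).filter (v ∈ ·)) fun C =>
      bigOp D.seq (C.erase v) fun a => some (α a)) y := by
  -- If `{v}` is a maximal chain, erasing `v` leaves an undefined value and distributivity is
  -- unavailable; but then it is the only maximal chain through `v`.
  by_cases h : {v} ∈ maxChains O
  · have : (maxChains O).filter (v ∈ ·) = {{v}} := by
      ext C
      rw [Finset.mem_filter, Finset.mem_singleton]
      constructor
      · rintro ⟨h1, h2⟩; exact eq_singleton_of_mem_maxChains h h1 h2
      · rintro rfl; exact ⟨h, Finset.mem_singleton_self v⟩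
    rw [this, bigOp_singleton, bigOp_singleton]
  · obtain ⟨C, hC, hvC⟩ := exists_mem_maxChains O hv
    rw [merge_comm, merge_bigOp D.conj D.seq_conj ⟨C, Finset.mem_filter.2 ⟨hC, hvC⟩⟩]
    · exact bigOp_congr _ fun _ _ => merge_comm _ _ _
    · intro K hK
      obtain ⟨hK, hvK⟩ := Finset.mem_filter.1 hK
      refine bigOp_isSome _ ?_ fun _ _ => rfl
      rw [Finset.nonempty_iff_ne_empty]
      intro he
      refine h ?_
      rwa [← insert_empty_eq, ← he, Finset.insert_erase hvK]

-- The chains through the module form a product, over which `seq` distributes in each factor: the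
-- conjunction over pairs `(C, K)` becomes one sequential composition.
open scoped Classical in
theorem Substitutable.dynWeight_subst (D : SemiringDynDomain V) (α : N → V) {v : N}
    {O P : Attack N} (h : Substitutable v O P) (hv : v ∈ O.1) :
    dynWeight D α (substAttack v O P) =
      Option.merge D.conj (bigOp D.conj ((maxChains O).filter (v ∉ ·)) fun C =>
        bigOp D.seq C fun a => some (α a))
      (Option.merge D.seq (bigOp D.conj ((maxChains O).filter (v ∈ ·)) fun C =>
        bigOp D.seq (C.erase v) fun a => some (α a)) (dynWeight D α P)) := by
  have hsubO : ∀ C ∈ maxChains O, C ⊆ O.1 := fun C hC => (mem_maxChains.1 hC).1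
  have hsubP : ∀ C ∈ maxChains P, C ⊆ P.1 := fun C hC => (mem_maxChains.1 hC).1
  have hdisj := h.disjoint
  -- Intersecting with `P.1` and with its complement recovers both parts of the chain, so gluing
  -- chains is injective.
  have split : ∀ C K : Finset N, C ⊆ O.1 → K ⊆ P.1 →
      C.erase v = (C.erase v ∪ K).filter (· ∉ P.1) ∧ K = (C.erase v ∪ K).filter (· ∈ P.1) := by
    intro C K hC hK
    have h1 : ∀ x ∈ C.erase v, x ∉ P.1 := fun x hx hx' =>
      hdisj x hx' (hC (Finset.mem_of_mem_erase hx))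
    constructor
    · ext x
      rw [Finset.mem_filter, Finset.mem_union]
      exact ⟨fun hx => ⟨.inl hx, h1 x hx⟩, fun hx => hx.1.resolve_right fun h => hx.2 (hK h)⟩
    · ext x
      rw [Finset.mem_filter, Finset.mem_union]
      exact ⟨fun hx => ⟨.inr hx, hK hx⟩, fun hx => hx.1.resolve_left fun h => h1 x h hx.2⟩
  rw [dynWeight, h.maxChains_subst hv, bigOp_union, bigOp_image, bigOp_product,
    ← bigOp_maxChains_through D α O v hv]
  · congr 1
    refine bigOp_congr _ fun C hC => ?_
    obtain ⟨b, hb⟩ := h.nonempty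
    obtain ⟨K, hK, -⟩ := exists_mem_maxChains P hb
    rw [dynWeight, merge_bigOp D.conj D.seq_conj ⟨K, hK⟩ fun K hK =>
      bigOp_isSome _ (nonempty_of_mem_maxChains h.nonempty hK) fun _ _ => rfl]
    refine bigOp_congr _ fun K hK => bigOp_union _ ?_ _
    exact Finset.disjoint_left.2 fun x hx hx' => hdisj x (hsubP K hK hx')
      (hsubO C (Finset.mem_filter.1 hC).1 (Finset.mem_of_mem_erase hx))
  · rintro ⟨C, K⟩ hCK ⟨C', K'⟩ hCK' heq
    simp only [Finset.mem_coe, Finset.mem_product, Finset.mem_filter] at hCK hCK' heq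
    obtain ⟨h1, h2⟩ := split C K (hsubO C hCK.1.1) (hsubP K hCK.2)
    obtain ⟨h1', h2'⟩ := split C' K' (hsubO C' hCK'.1.1) (hsubP K' hCK'.2)
    refine Prod.ext ?_ (by rw [h2, heq, ← h2'])
    rw [← Finset.insert_erase hCK.1.2, h1, heq, ← h1', Finset.insert_erase hCK'.1.2]
  · refine Finset.disjoint_left.2 fun E hE hE' => ?_
    obtain ⟨⟨C, K⟩, hCK, rfl⟩ := Finset.mem_image.1 hE'
    obtain ⟨x, hx⟩ := nonempty_of_mem_maxChains h.nonempty (Finset.mem_product.1 hCK).2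
    exact hdisj x (hsubP K (Finset.mem_product.1 hCK).2 hx)
      (hsubO _ (Finset.mem_filter.1 hE).1 (Finset.mem_union_right _ hx))

open scoped Classical in
theorem dynWeight_update (D : SemiringDynDomain V) (α : N → V) {v : N}
    {O : Attack N} (hv : v ∈ O.1) (m : V) :
    dynWeight D (Function.update α v m) O =
      Option.merge D.conj (bigOp D.conj ((maxChains O).filter (v ∉ ·)) fun C =>
        bigOp D.seq C fun a => some (α a))
      (Option.merge D.seq (bigOp D.conj ((maxChains O).filter (v ∈ ·)) fun C =>
        bigOp D.seq (C.erase v) fun a => some (α a)) (some m)) := by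
  rw [dynWeight, bigOp_filter D.conj _ (v ∉ ·), ← bigOp_maxChains_through D α O v hv]
  simp only [not_not]
  congr 1
  · refine bigOp_congr _ fun C hC => bigOp_congr _ fun a ha => ?_
    rw [Function.update_of_ne (by rintro rfl; exact (Finset.mem_filter.1 hC).2 ha)]
  · refine bigOp_congr _ fun C hC => ?_
    conv_lhs => rw [← Finset.insert_erase (Finset.mem_filter.1 hC).2]
    rw [bigOp_insert _ (Finset.notMem_erase v C), merge_comm, Function.update_self]
    congr 1
    exact bigOp_congr _ fun a ha => by rw [Function.update_of_ne (Finset.ne_of_mem_erase ha)]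

/-- Both `dynWeight_subst` and `dynWeight_update` have the form `X △ (Y ▷ z)`, and this function of
`z` commutes with nonempty disjunctions of defined values. -/
theorem dynWeight_isModularWeight (D : SemiringDynDomain V) :
    IsModularWeight (N := N) D.toSemiringDomain (dynWeight D) where
  congr α β O h := bigOp_congr _ fun C hC => bigOp_congr _ fun a ha => by
    rw [h a ((mem_maxChains.1 hC).1 ha)]
  singleton α a := by rw [dynWeight, maxChains_singleton, bigOp_singleton, bigOp_singleton]
  subst α v O m S hv hS h hm := by
    have hs : ∀ P ∈ S, (dynWeight D α P).isSome := fun P hP => dynWeight_isSome D α (h P hP).nonempty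
    rw [dynWeight_update D α hv, ← hm, merge_bigOp _ D.seq_disj hS hs,
      merge_bigOp _ D.conj_disj hS]
    · exact bigOp_congr _ fun P hP => ((h P hP).dynWeight_subst D α hv).symm
    · intro P hP
      have := hs P hP
      revert this
      generalize dynWeight D α P = y
      cases y <;> simp

end Weights

namespace AttackTree

variable {N : Type u} {V : Type w} {T : AttackTree N}

/-! ### Static trees as dynamic trees -/

theorem staticReaches_iff (hT : T.IsAttackTree) (hs : T.IsStatic) {O : Attack N} {x : N}
    (hx : x ∈ T.nodes) : T.StaticReaches O.1 x ↔ T.DynReaches O x := by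
  constructor
  · intro h
    induction h with
    | bas v h1 h2 => exact .bas v h1 h2
    | or v u h1 h2 _ ih => exact .or v u h1 h2 (ih (hT.ch_mem v hx u h2))
    | and v h1 _ ih => exact .and v h1 fun u hu => ih u hu (hT.ch_mem v hx u hu)
  · intro h
    induction h with
    | bas v h1 h2 => exact .bas v h1 h2
    | or v u h1 h2 _ ih => exact .or v u h1 h2 (ih (hT.ch_mem v hx u h2))
    | and v h1 _ ih => exact .and v h1 fun u hu => ih u hu (hT.ch_mem v hx u hu)
    | sand v h1 => exact absurd h1 (hs v hx)

theorem dynSuccessful_iff_of_isStatic (hT : T.IsAttackTree) (hs : T.IsStatic) {O : Attack N} :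
    T.DynSuccessful O ↔ T.IsDynAttack O ∧ T.StaticSuccessful O.1 := by
  constructor
  · rintro ⟨hO, r, hr, h⟩
    exact ⟨hO, hO.subset_bas, r, hr, (staticReaches_iff hT hs hr.1).2 h⟩
  · rintro ⟨hO, -, r, hr, h⟩
    exact ⟨hO, r, hr, (staticReaches_iff hT hs hr.1).1 h⟩

theorem isDynAttack_empty {A : Finset N} (h : A ⊆ T.bas) : T.IsDynAttack (A, ∅) :=
  ⟨h, fun _ _ h => absurd h (Finset.notMem_empty _), fun _ => Finset.notMem_empty _,
    fun _ _ _ h => absurd h (Finset.notMem_empty _)⟩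

theorem mem_staticMinAttacks {A : Finset N} :
    A ∈ T.staticMinAttacks ↔ Minimal T.StaticSuccessful A := by
  simp only [staticMinAttacks, Finset.mem_filter, Finset.mem_powerset, and_iff_right_iff_imp]
  exact fun h => h.1.1

-- Without sequential gates, success ignores the order relation, so minimality removes it.
open scoped Classical in
theorem dynMinAttacks_of_isStatic (hT : T.IsAttackTree) (hs : T.IsStatic) :
    T.dynMinAttacks = T.staticMinAttacks.image fun A => (A, ∅) := by
  ext O
  simp only [Finset.mem_image, mem_dynMinAttacks, mem_staticMinAttacks]
  have key : ∀ {A}, T.StaticSuccessful A → T.DynSuccessful (A, ∅) := fun h =>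
    (dynSuccessful_iff_of_isStatic hT hs).2 ⟨isDynAttack_empty h.1, h⟩
  constructor
  · intro hO
    have h1 := ((dynSuccessful_iff_of_isStatic hT hs).1 hO.1).2
    have h2 : (O.1, ∅) = O := hO.eq_of_le (key h1) ⟨le_rfl, Finset.empty_subset _⟩
    exact ⟨O.1, ⟨h1, fun A hA hle => (hO.2 (key hA) ⟨hle, Finset.empty_subset _⟩).1⟩, h2⟩
  · rintro ⟨A, hA, rfl⟩
    refine ⟨key hA.1, fun Q hQ hle => ⟨?_, Finset.empty_subset _⟩⟩
    exact hA.2 ((dynSuccessful_iff_of_isStatic hT hs).1 hQ).2 hle.1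

theorem staticMetric_eq (D : SemiringDomain V) (hT : T.IsAttackTree) (hs : T.IsStatic)
    (α : N → V) : T.staticMetric D α = bigOp D.disj T.dynMinAttacks (staticWeight D α) := by
  classical
  rw [dynMinAttacks_of_isStatic hT hs, bigOp_image]
  · rfl
  · exact fun _ _ _ _ h => (Prod.ext_iff.1 h).1

/-- The attack by all basic steps reaches every node, by induction from the leaves. -/
theorem dynReaches_of_isStatic (hT : T.IsAttackTree) (hs : T.IsStatic) {x : N}
    (hx : x ∈ T.nodes) : T.DynReaches (T.bas, ∅) x := by
  refine node_induction hT (p := T.DynReaches (T.bas, ∅)) (fun x hx ih => ?_) hx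
  cases h : T.typ x with
  | BAS => exact .bas x h (mem_bas.2 ⟨hx, h⟩)
  | OR =>
    have : T.ch x ≠ [] := fun h' => by simpa [h] using (hT.bas_iff_leaf x hx).2 h'
    obtain ⟨y, hy⟩ := List.exists_mem_of_ne_nil _ this
    exact .or x y h hy (ih y hy)
  | AND => exact .and x h ih
  | SAND => exact absurd h (hs x hx)

/-- All modules of a static attack tree are satisfiable. -/
theorem satisfiable_sub_of_isStatic (hT : T.IsAttackTree) (hs : T.IsStatic) {v : N}
    (hv : v ∈ T.nodes) : (T.sub v).Satisfiable :=
  (satisfiable_sub_iff hT hv).2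
    ⟨(T.bas, ∅), isDynAttack_empty (Finset.Subset.refl _), dynReaches_of_isStatic hT hs hv⟩

/-! ### Metrics and contraction -/

theorem dynSuccessful_singleton {r : N} (hr : T.IsRoot r) (h : T.typ r = NodeType.BAS) :
    T.DynSuccessful ({r}, ∅) :=
  ⟨isDynAttack_empty (Finset.singleton_subset_iff.2 (mem_bas.2 ⟨hr.1, h⟩)), r, hr,
    .bas r h (Finset.mem_singleton_self r)⟩

theorem dynMinAttacks_of_root_bas (hT : T.IsAttackTree) {r : N} (hr : T.IsRoot r)
    (h : T.typ r = NodeType.BAS) : T.dynMinAttacks = {({r}, ∅)} := by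
  have hle : ∀ O, T.DynSuccessful O → ({r}, ∅) ≤ O := by
    intro O hO
    refine ⟨Finset.singleton_subset_iff.2 ?_, Finset.empty_subset _⟩
    have := ((hr.dynSuccessful_iff hT).1 hO).2
    cases this <;> simp_all
  ext O
  rw [mem_dynMinAttacks, Finset.mem_singleton]
  constructor
  · exact fun hO => (hO.eq_of_le (dynSuccessful_singleton hr h) (hle O hO.1)).symm
  · rintro rfl
    exact ⟨dynSuccessful_singleton hr h, fun Q hQ _ => hle Q hQ⟩

theorem satisfiable_of_modules (hT : T.IsAttackTree)
    (h : ∀ v ∈ T.modules, (T.sub v).Satisfiable) : T.Satisfiable := by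
  obtain ⟨r, hr, -⟩ := hT.unique_root
  by_cases hb : T.typ r = NodeType.BAS
  · exact ⟨_, dynSuccessful_singleton hr hb⟩
  · obtain ⟨O, hO⟩ := (satisfiable_sub_iff hT hr.1).1 (h r (mem_modules.2 (hr.isModule hT hb)))
    exact ⟨O, (hr.dynSuccessful_iff hT).2 hO⟩

open scoped Classical in
/-- Contraction of a module whose metric becomes the attribute of the new step does not change
the metric. -/
theorem IsModule.bigOp_contract {D : SemiringDomain V} {W : (N → V) → Attack N → Option V}
    (hW : IsModularWeight D W) (hT : T.IsAttackTree) {v : N} (hv : T.IsModule v)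
    (hsat : (T.sub v).Satisfiable) {α : N → V} {m : V}
    (hm : bigOp D.disj (T.sub v).dynMinAttacks (W α) = some m) :
    bigOp D.disj (T.contract v).dynMinAttacks (W (Function.update α v m)) =
      bigOp D.disj T.dynMinAttacks (W α) := by
  rw [hv.bigOp_dynMinAttacks D.disj hT hsat]
  refine bigOp_congr _ fun O hO => ?_
  by_cases hvO : v ∈ O.1
  · rw [if_pos hvO]
    obtain ⟨P, -, hP⟩ := hsat.choose_spec.exists_minimal_le
    exact hW.subst α v O m _ hvO ⟨P, hP⟩ (fun Q hQ => hv.substitutable hT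
      (mem_dynMinAttacks.1 hO).1.1 (mem_dynMinAttacks.1 hQ).1) hm
  · rw [if_neg hvO]
    refine hW.congr _ _ _ fun a ha => Function.update_of_ne ?_ _ _
    rintro rfl
    exact hvO ha

end AttackTree

/-! ### Correctness of modular analysis -/

namespace ModState

variable {N : Type u} {V : Type w}

/-- The invariant of modular analysis. Here `K` is the class of trees that are considered and `x` is
the metric of the original tree. -/
structure Invariant (K : AttackTree N → Prop) (D : SemiringDomain V)
    (W : (N → V) → Attack N → Option V) (x : V) (s : ModState N V) : Prop where
  isAttackTree : s.tree.IsAttackTree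
  mem_class : K s.tree
  isModule : ∀ v ∈ s.pending, s.tree.IsModule v
  satisfiable : ∀ v ∈ s.pending, (s.tree.sub v).Satisfiable
  root_pending : ∀ r, s.tree.IsRoot r → s.tree.typ r ≠ NodeType.BAS → r ∈ s.pending
  metric : bigOp D.disj s.tree.dynMinAttacks (W s.attr) = some x

variable {K : AttackTree N → Prop} {D : SemiringDomain V} {W : (N → V) → Attack N → Option V}
  {x : V} {alg : AttackTree N → (N → V) → V} {s s' : ModState N V}

/-- Minimality of the chosen `v` keeps every other pending module outside the deleted part, so it
survives as a satisfiable module. The metric is preserved by `IsModule.bigOp_contract`. -/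
theorem Invariant.step (hW : IsModularWeight D W)
    (hsub : ∀ T : AttackTree N, K T → ∀ v, K (T.sub v))
    (hcontract : ∀ T : AttackTree N, K T → ∀ v, K (T.contract v))
    (halg : ∀ T : AttackTree N, T.IsAttackTree → K T → T.Satisfiable →
      ∀ β, bigOp D.disj T.dynMinAttacks (W β) = some (alg T β))
    (h : Invariant K D W x s) (hs : Step alg s s') : Invariant K D W x s' := by
  classical
  obtain ⟨v, ⟨hv, hmin⟩, rfl⟩ := hs
  have hT := h.isAttackTree
  have hvm := h.isModule v hv
  have hsat := h.satisfiable v hv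
  have hpend : ∀ w ∈ (s.next alg v).pending, w ∈ s.pending ∧ w ≠ v ∧ ¬ s.tree.Desc v w := by
    intro w hw
    have hw : w ≠ v ∧ w ∈ s.pending := by simpa only [next, Finset.mem_erase] using hw
    exact ⟨hw.2, hw.1, fun h3 => hw.1 (hmin w hw.2 h3)⟩
  constructor
  · exact hvm.contract_isAttackTree hT
  · exact hcontract _ h.mem_class v
  · intro w hw
    obtain ⟨h1, h2, h3⟩ := hpend w hw
    exact (h.isModule w h1).contract hT h2 h3
  · intro w hw
    obtain ⟨h1, h2, h3⟩ := hpend w hw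
    refine AttackTree.satisfiable_sub_contract hT hvm ?_ (h.satisfiable w h1)
    exact AttackTree.mem_nodes_contract.2 ⟨(h.isModule w h1).1, fun h' => absurd h' h3⟩
  · intro r hr hb
    have hr := (hvm.isRoot_contract_iff hT).1 hr
    have hrv : r ≠ v := by
      rintro rfl
      exact hb AttackTree.typ_contract_self
    have hb' : s.tree.typ r ≠ NodeType.BAS := by
      rw [← AttackTree.typ_contract hrv]; exact hb
    simpa only [next, Finset.mem_erase] using ⟨hrv, h.root_pending r hr hb'⟩
  · exact (hvm.bigOp_contract hW hT hsat (halg _ (hT.sub hvm.1) (hsub _ h.mem_class v) hsat _)).trans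
      h.metric

theorem Step.card_lt (hs : Step alg s s') : s'.pending.card < s.pending.card := by
  obtain ⟨v, ⟨hv, -⟩, rfl⟩ := hs
  classical
  exact Finset.card_erase_lt_of_mem hv

theorem acc_step (alg : AttackTree N → (N → V) → V) (s : ModState N V) :
    Acc (fun s' s => Step alg s s') s := by
  have h : WellFounded fun s' s : ModState N V => s'.pending.card < s.pending.card :=
    (measure fun s : ModState N V => s.pending.card).wf
  exact Subrelation.accessible (fun h => Step.card_lt h) (h.apply s)

theorem Invariant.exists_step (h : Invariant K D W x s) (hs : s.pending.Nonempty)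
    (alg : AttackTree N → (N → V) → V) : ∃ s', Step alg s s' := by
  have hT := h.isAttackTree
  obtain ⟨v₀, hv₀⟩ := hs
  obtain ⟨⟨v, hvT⟩, hv, hmin⟩ := (AttackTree.wellFounded_desc hT).has_min
    {a | a.1 ∈ s.pending} ⟨⟨v₀, (h.isModule v₀ hv₀).1⟩, hv₀⟩
  refine ⟨_, v, ⟨hv, fun w hw hd => ?_⟩, rfl⟩
  rcases Relation.reflTransGen_iff_eq_or_transGen.1 hd with h1 | h1
  · exact h1
  · exact absurd h1 (hmin ⟨w, (h.isModule w hw).1⟩ hw)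

theorem Invariant.output (hW : IsModularWeight D W) (h : Invariant K D W x s)
    (hs : s.pending = ∅) {r : N} (hr : s.tree.IsRoot r) :
    s.tree.typ r = NodeType.BAS ∧ s.attr r = x := by
  have hb : s.tree.typ r = NodeType.BAS := by
    by_contra hb
    simpa [hs] using h.root_pending r hr hb
  refine ⟨hb, ?_⟩
  have hm := h.metric
  rw [AttackTree.dynMinAttacks_of_root_bas h.isAttackTree hr hb, bigOp_singleton,
    hW.singleton] at hm
  exact Option.some_injective _ hm

end ModState

/-- Modular analysis is correct for every metric that is the disjunction of the values of the
minimal attacks, if these values are compatible with substitution. -/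
theorem modularAnalysisReturns_of_isModularWeight {N : Type u} {V : Type w}
    {K : AttackTree N → Prop} {D : SemiringDomain V} {W : (N → V) → Attack N → Option V}
    (hW : IsModularWeight D W) (hsub : ∀ T : AttackTree N, K T → ∀ v, K (T.sub v))
    (hcontract : ∀ T : AttackTree N, K T → ∀ v, K (T.contract v))
    {alg : AttackTree N → (N → V) → V}
    (halg : ∀ T : AttackTree N, T.IsAttackTree → K T → T.Satisfiable →
      ∀ β, bigOp D.disj T.dynMinAttacks (W β) = some (alg T β))
    {T : AttackTree N} (α : N → V) (hT : T.IsAttackTree) (hK : K T)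
    (hsat : ∀ v ∈ T.modules, (T.sub v).Satisfiable) :
    ∃ x : V, bigOp D.disj T.dynMinAttacks (W α) = some x ∧ ModularAnalysisReturns alg T α x := by
  have hx := halg T hT hK (AttackTree.satisfiable_of_modules hT hsat) α
  have hinit : ModState.Invariant K D W (alg T α) (ModState.init T α) :=
    ⟨hT, hK, fun v hv => AttackTree.mem_modules.1 hv, hsat,
      fun r hr hb => AttackTree.mem_modules.2 (hr.isModule hT hb), hx⟩
  have hinv : ∀ s, Relation.ReflTransGen (ModState.Step alg) (ModState.init T α) s →
      ModState.Invariant K D W (alg T α) s := by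
    intro s hs
    induction hs with
    | refl => exact hinit
    | tail _ hs ih => exact ih.step hW hsub hcontract halg hs
  exact ⟨alg T α, hx, ModState.acc_step alg _, fun s hs hne => (hinv s hs).exists_step hne alg,
    fun s hs he => ⟨(hinv s hs).isAttackTree.unique_root, fun r hr => (hinv s hs).output hW he hr⟩⟩

end AttackTrees

/-! ### Specialization to the static and dynamic metrics -/

theorem mainTheorem12 {N : Type*} {V : Type*} :
    (∀ (D : AttackTrees.SemiringDomain V) (alg : AttackTrees.AttackTree N → (N → V) → V),
      (∀ T' : AttackTrees.AttackTree N, T'.IsAttackTree → T'.IsStatic →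
        ∀ β : N → V, T'.staticMetric D β = some (alg T' β)) →
      ∀ (T : AttackTrees.AttackTree N) (α : N → V), T.IsAttackTree → T.IsStatic →
        ∃ x : V, T.staticMetric D α = some x ∧
          AttackTrees.ModularAnalysisReturns alg T α x) ∧
    (∀ (D : AttackTrees.SemiringDynDomain V) (alg : AttackTrees.AttackTree N → (N → V) → V),
      (∀ T' : AttackTrees.AttackTree N, T'.IsAttackTree → T'.Satisfiable →
        ∀ β : N → V, T'.dynMetric D β = some (alg T' β)) →
      ∀ (T : AttackTrees.AttackTree N) (α : N → V), T.IsAttackTree →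
        (∀ v ∈ T.modules, (T.sub v).Satisfiable) →
        ∃ x : V, T.dynMetric D α = some x ∧
          AttackTrees.ModularAnalysisReturns alg T α x) := by
  constructor
  · intro D alg halg T α hT hs
    rw [AttackTrees.AttackTree.staticMetric_eq D hT hs]
    refine AttackTrees.modularAnalysisReturns_of_isModularWeight
      (K := AttackTrees.AttackTree.IsStatic) (AttackTrees.staticWeight_isModularWeight D)
      (fun T h v => h.sub v) (fun T h v => h.contract v) (fun T' hT' hs' _ β => ?_) α hT hs
      fun v hv => AttackTrees.AttackTree.satisfiable_sub_of_isStatic hT hs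
        (AttackTrees.AttackTree.mem_modules.1 hv).1
    rw [← AttackTrees.AttackTree.staticMetric_eq D hT' hs']
    exact halg T' hT' hs' β
  · intro D alg halg T α hT hsat
    exact AttackTrees.modularAnalysisReturns_of_isModularWeight (K := fun _ => True)
      (AttackTrees.dynWeight_isModularWeight D) (fun _ _ _ => trivial) (fun _ _ _ => trivial)
      (fun T' hT' _ hs' β => halg T' hT' hs' β) α hT trivial hsat
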